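/- Let $W=(W_t)_{t\ge 0}$ be a $d$-dimensional Brownian motion started at $0$ on a filtered probability space $(\Omega,\mathcal F,(\mathcal F_t)_{t\ge 0},\mathbb P)$. Let $f:\mathbb R^d\to\mathbb R$ be a convex function of at most polynomial growth, that is, $f(x)\le C(1+\|x\|)^k$ for all $x$, for some $C\in\mathbb R$ and $k\in\mathbb N$. For every $x\in\mathbb R^d$ let $p(x)$ be a subgradient of $f$ at $x$, i.e. $f(x)+\langle p(x),y-x\rangle\le f(y)$ for all $y\in\mathbb R^d$. Then $f$ has a second derivative measure: there is a matrix $\mu=(\mu_{ij})_{1\le i,j\le d}$ of signed Radon measures on $\mathbb R^d$ (each a difference of two locally finite Borel measures) such that $$\int_{\mathbb R^d}\varphi\,d\mu_{ij}=\int_{\mathbb R^d} f\,\frac{\partial^2\varphi}{\partial x_i\partial x_j}\,dx\qquad\text{for all }\varphi\in C_c^\infty(\mathbb R^d)\text{ and all } i,j.$$ For this measure $\mu$, let $Q(x)=(Q(x)_{ij})$ be the matrix of the Radon--Nikodym derivatives with respect to Lebesgue measure, $Q(x)_{ij}=\frac{d\mu_{ij}}{dx}(x)$ (the density of the absolutely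 continuous part of $\mu_{ij}$). Then for Lebesgue-almost every $x\in\mathbb R^d$, the random variable $f(x+W_t)-f(x)-\langle p(x),W_t\rangle-\tfrac12\langle Q(x)W_t,W_t\rangle$ is integrable for every $t\ge 0$, and $$\lim_{t\downarrow 0}\frac1t\,\mathbb E\Big[\big|f(x+W_t)-f(x)-\langle p(x),W_t\rangle-\tfrac12\langle Q(x)W_t,W_t\rangle\big|\Big]=0 .$$ -/

import Mathlib

open MeasureTheory ProbabilityTheory Filter Topology
open scoped NNReal ENNReal

/-- `f` has at most polynomial growth. For a convex `f` the upper bound suffices, because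
`f x ≥ 2 * f 0 - f (-x)`. -/
def HasAtMostPolynomialGrowth {d : ℕ} (f : EuclideanSpace ℝ (Fin d) → ℝ) : Prop :=
  ∃ C : ℝ, ∃ k : ℕ, ∀ x, f x ≤ C * (1 + ‖x‖) ^ k

/-- `p` is a choice of subgradient of `f`: at every `x`, the vector `p x` is a subgradient. -/
def IsSubgradientChoice {d : ℕ} (f : EuclideanSpace ℝ (Fin d) → ℝ)
    (p : EuclideanSpace ℝ (Fin d) → EuclideanSpace ℝ (Fin d)) : Prop :=
  ∀ x y, f x + inner ℝ (p x) (y - x) ≤ f y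

/-- A signed Radon measure on `ℝ^d`, given as a difference `pos - neg` of two locally finite Borel
measures. Neither may be finite, so the difference need not be a `SignedMeasure`. The integral
and the density below do not depend on the way the signed measure is written as a difference. -/
structure SignedRadonMeasure (d : ℕ) where
  pos : Measure (EuclideanSpace ℝ (Fin d))
  neg : Measure (EuclideanSpace ℝ (Fin d))
  isLocallyFinite_pos : IsLocallyFiniteMeasure pos
  isLocallyFinite_neg : IsLocallyFiniteMeasure neg

/-- The integral of a (continuous, compactly supported) function against `μ = pos - neg`. -/
noncomputable def SignedRadonMeasure.integral {d : ℕ} (μ : SignedRadonMeasure d)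
    (φ : EuclideanSpace ℝ (Fin d) → ℝ) : ℝ :=
  ∫ x, φ x ∂μ.pos - ∫ x, φ x ∂μ.neg

/-- The Radon-Nikodym derivative `dμ/dx` (the density of the absolutely continuous part of `μ`)
with respect to Lebesgue measure. -/
noncomputable def SignedRadonMeasure.density {d : ℕ} (μ : SignedRadonMeasure d)
    (x : EuclideanSpace ℝ (Fin d)) : ℝ :=
  (μ.pos.rnDeriv volume x).toReal - (μ.neg.rnDeriv volume x).toReal

/-- The second partial derivative `∂²φ / ∂xᵢ ∂xⱼ` at `x`. -/
noncomputable def secondPartial {d : ℕ} (i j : Fin d) (φ : EuclideanSpace ℝ (Fin d) → ℝ)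
    (x : EuclideanSpace ℝ (Fin d)) : ℝ :=
  fderiv ℝ (fun y => fderiv ℝ φ y (EuclideanSpace.single j 1)) x (EuclideanSpace.single i 1)

/-- The matrix-valued Radon measure `μ = (μᵢⱼ)` is the second derivative measure of `f`:
`∫ φ dμᵢⱼ = ∫ f ∂ᵢ∂ⱼφ dx` for all `φ ∈ C_c^∞(ℝ^d)`. -/
def IsSecondDerivativeMeasure {d : ℕ} (f : EuclideanSpace ℝ (Fin d) → ℝ)
    (μ : Matrix (Fin d) (Fin d) (SignedRadonMeasure d)) : Prop :=
  ∀ i j, ∀ φ : EuclideanSpace ℝ (Fin d) → ℝ, ContDiff ℝ ((⊤ : ℕ∞) : WithTop ℕ∞) φ → HasCompactSupport φ →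
    (μ i j).integral φ = ∫ x, f x * secondPartial i j φ x

/-- The matrix `Q(x)` of densities `Q(x)ᵢⱼ = dμᵢⱼ/dx`. -/
noncomputable def densityMatrix {d : ℕ} (μ : Matrix (Fin d) (Fin d) (SignedRadonMeasure d))
    (x : EuclideanSpace ℝ (Fin d)) : Matrix (Fin d) (Fin d) ℝ :=
  Matrix.of fun i j => (μ i j).density x

/-- `W` is a `d`-dimensional Brownian motion started at `0` with respect to the filtration `ℱ`. -/
structure IsBrownianMotion {d : ℕ} {Ω : Type*} {mΩ : MeasurableSpace Ω} (P : Measure Ω)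
    (ℱ : Filtration ℝ≥0 mΩ) (W : ℝ≥0 → Ω → EuclideanSpace ℝ (Fin d)) : Prop where
  adapted : Adapted ℱ W
  eval_zero : ∀ᵐ ω ∂P, W 0 ω = 0
  hasLaw_increment : ∀ s t : ℝ≥0, s ≤ t →
    HasLaw (fun ω => W t ω - W s ω)
      (multivariateGaussian 0 (((t : ℝ) - (s : ℝ)) • (1 : Matrix (Fin d) (Fin d) ℝ))) P
  indep_increment : ∀ s t : ℝ≥0, s ≤ t →
    Indep (MeasurableSpace.comap (fun ω => W t ω - W s ω) inferInstance) (ℱ s) P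
  continuous_paths : ∀ᵐ ω ∂P, Continuous fun t => W t ω

/-- The second-order remainder
`f(x + w) - f(x) - ⟨p, w⟩ - (1/2) ⟨Q w, w⟩`. -/
noncomputable def secondOrderRemainder {d : ℕ} (f : EuclideanSpace ℝ (Fin d) → ℝ)
    (x p : EuclideanSpace ℝ (Fin d)) (Q : Matrix (Fin d) (Fin d) ℝ)
    (w : EuclideanSpace ℝ (Fin d)) : ℝ :=
  f (x + w) - f x - inner ℝ p w - (1 / 2 : ℝ) * inner ℝ (Q.toEuclideanLin w) w

/-! Fix `x` and put `G w = f (x + w) - f x - ⟨p x, w⟩`, a nonnegative convex function vanishing at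
`0`. The core is Alexandrov's theorem in a weak form: for almost every `x`, `r⁻² G (r w) → ½⟨Q w,
w⟩` as `r ↓ 0`, for each fixed `w`. Convergence along rays is enough, because `W_t` has the law of
`√t Z` with `Z` standard Gaussian. The scaled expectation is then an integral over the law of `Z`,
and dominated convergence applies, the majorant coming from a quadratic bound near `0` and
polynomial growth away from it (`IsBrownianMotion.tendsto_integral_abs`).

Rescaling `f` around `x` rescales its second derivative measure. At almost every `x` the singular
part disappears in the limit and the density becomes the constant `Q x` (`ae_eventually_blowup`).
Tested against smooth functions, the second differences of the blow-ups therefore converge to those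
of the quadratic form (`ae_tendsto_integral_secondDifference`).

Convexity makes this weak convergence pointwise. Averaged second differences control the values of
`G`, so `G w ≤ C ‖w‖²` near `0` (`ConvexOn.exists_le_mul_sq`). The blow-ups are then locally bounded
and convex, hence equi-Lipschitz, and their averaged second differences are close to pointwise ones.
With `a r = r⁻² G (r v)`, the second difference at `v` in direction `v` is `4 a (2r) - 2 a r`, since
`G 0 = 0`; its convergence to `q` forces `a → q / 2` for bounded `a`.

The measure itself exists because second differences of a convex function are nonnegative: their
limits are positive functionals, represented by Riesz's theorem, and polarization gives the mixed
entries. -/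

/-! ### Second differences integrated against test functions. -/

section SecondDifference

variable {E : Type*} [NormedAddCommGroup E] [NormedSpace ℝ E] [FiniteDimensional ℝ E]
  [MeasurableSpace E] [BorelSpace E] {μ : Measure E} [μ.IsAddHaarMeasure]

/-- The symmetric second difference of `F` in the direction `v`. -/
def secondDifference {E : Type*} [AddCommGroup E] (F : E → ℝ) (v w : E) : ℝ :=
  F (w + v) + F (w - v) - 2 * F w

/-- The second derivative of `φ` in the direction `v`. -/
noncomputable def secondLineDeriv (φ : E → ℝ) (v w : E) : ℝ :=
  fderiv ℝ (fun y => fderiv ℝ φ y v) w v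

lemma integral_add_sub_two_mul {α : Type*} [MeasurableSpace α] {ν : Measure α} {a b c : α → ℝ}
    (ha : Integrable a ν) (hb : Integrable b ν) (hc : Integrable c ν) :
    ∫ w, (a w + b w - 2 * c w) ∂ν = ∫ w, a w ∂ν + ∫ w, b w ∂ν - 2 * ∫ w, c w ∂ν := by
  have h := integral_sub (ha.add hb) (hc.const_mul 2)
  rw [integral_const_mul] at h
  rw [← integral_add ha hb]
  exact h

omit [NormedSpace ℝ E] [FiniteDimensional ℝ E] in
lemma continuous_mul_integrable {F φ : E → ℝ} (hF : Continuous F) (hφ : Continuous φ)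
    (hs : HasCompactSupport φ) : Integrable (fun w => F w * φ w) μ :=
  (hF.mul hφ).integrable_of_hasCompactSupport hs.mul_left

omit [NormedSpace ℝ E] [FiniteDimensional ℝ E] [MeasurableSpace E] [BorelSpace E] in
lemma hasCompactSupport_translate {φ : E → ℝ} (hs : HasCompactSupport φ) (v : E) :
    HasCompactSupport fun w => φ (w + v) :=
  hs.comp_homeomorph (Homeomorph.addRight v)

omit [FiniteDimensional ℝ E] [MeasurableSpace E] [BorelSpace E] in
lemma contDiff_fderiv_apply {φ : E → ℝ} (hφ : ContDiff ℝ ((⊤ : ℕ∞) : WithTop ℕ∞) φ) (v : E) :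
    ContDiff ℝ ((⊤ : ℕ∞) : WithTop ℕ∞) fun y => fderiv ℝ φ y v :=
  (hφ.fderiv_right (m := ((⊤ : ℕ∞) : WithTop ℕ∞)) (by simp)).clm_apply contDiff_const

omit [FiniteDimensional ℝ E] in
lemma hasDerivAt_integral_mul_translate {F φ : E → ℝ} (hF : Continuous F)
    (hφ : ContDiff ℝ 1 φ) (hs : HasCompactSupport φ) (v : E) (s₀ : ℝ) :
    HasDerivAt (fun s : ℝ => ∫ w, F w * φ (w + s • v) ∂μ)
      (∫ w, F w * fderiv ℝ φ (w + s₀ • v) v ∂μ) s₀ := by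
  have hφ' : Continuous fun y => fderiv ℝ φ y v :=
    (hφ.continuous_fderiv (by simp)).clm_apply continuous_const
  have hs' : HasCompactSupport fun y => fderiv ℝ φ y v := hs.fderiv_apply (𝕜 := ℝ) v
  obtain ⟨M, hM⟩ := hφ'.bounded_above_of_compact_support hs'
  -- `K` is the compact set swept by the translated supports for `|s - s₀| ≤ 1`; it carries the
  -- dominating function.
  set K : Set E := (fun z : E × ℝ => z.1 - z.2 • v) ''
    (tsupport (fun y => fderiv ℝ φ y v) ×ˢ Set.Icc (s₀ - 1) (s₀ + 1)) with hK
  have hKc : IsCompact K := by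
    refine IsCompact.image (hs'.isCompact.prod isCompact_Icc) (by fun_prop)
  have hb : Integrable (K.indicator fun w => |F w| * M) μ := by
    rw [integrable_indicator_iff hKc.measurableSet]
    exact (ContinuousOn.integrableOn_compact hKc (by fun_prop))
  refine (hasDerivAt_integral_of_dominated_loc_of_deriv_le
    (F := fun s w => F w * φ (w + s • v)) (F' := fun s w => F w * fderiv ℝ φ (w + s • v) v)
    (bound := K.indicator fun w => |F w| * M)
    (Metric.ball_mem_nhds s₀ one_pos) (.of_forall fun s => ?_) ?_ ?_ ?_ hb ?_).2
  · have := hφ.continuous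
    exact (by fun_prop : Continuous fun w => F w * φ (w + s • v)).aestronglyMeasurable
  · exact continuous_mul_integrable hF (hφ.continuous.comp (by fun_prop))
      (hasCompactSupport_translate hs _)
  · exact (hF.mul (hφ'.comp (by fun_prop : Continuous fun w => w + s₀ • v))).aestronglyMeasurable
  · refine .of_forall fun w s hsb => ?_
    by_cases hw : w ∈ K
    · rw [Set.indicator_of_mem hw, norm_mul, Real.norm_eq_abs]
      exact mul_le_mul_of_nonneg_left (hM _) (abs_nonneg _)
    · rw [Set.indicator_of_notMem hw]
      have : fderiv ℝ φ (w + s • v) v = 0 := by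
        by_contra hne
        refine hw ⟨(w + s • v, s), ⟨subset_tsupport _ hne, ?_⟩, by simp⟩
        rw [Metric.mem_ball, Real.dist_eq, abs_lt] at hsb
        constructor <;> linarith [hsb.1, hsb.2]
      simp [this]
  · refine .of_forall fun w s _ => ?_
    have h1 : HasFDerivAt φ (fderiv ℝ φ (w + s • v)) (w + s • v) :=
      ((hφ.differentiable (by simp)) _).hasFDerivAt
    have h2 : HasDerivAt (fun s : ℝ => w + s • v) v s := by
      simpa using ((hasDerivAt_id s).smul_const v).const_add w
    exact (h1.comp_hasDerivAt s h2).const_mul (F w)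

-- Two applications of the mean value theorem to `g s = ∫ F w * φ (w + s • v)`. The result is an
-- exact identity, so no Taylor remainder has to be estimated; the price is a translation by an
-- unknown `η • v` with `|η| < 1`.
omit [FiniteDimensional ℝ E] in
lemma exists_integral_mul_secondDifference_eq {F φ : E → ℝ} (hF : Continuous F)
    (hφ : ContDiff ℝ ((⊤ : ℕ∞) : WithTop ℕ∞) φ) (hs : HasCompactSupport φ) (v : E) :
    ∃ η ∈ Set.Ioo (-1 : ℝ) 1, ∫ w, F w * secondDifference φ v w ∂μ =
      ∫ w, F w * secondLineDeriv φ v (w + η • v) ∂μ := by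
  set g : ℝ → ℝ := fun s => ∫ w, F w * φ (w + s • v) ∂μ
  set g' : ℝ → ℝ := fun s => ∫ w, F w * fderiv ℝ φ (w + s • v) v ∂μ
  have hg : ∀ s, HasDerivAt g (g' s) s := fun s =>
    hasDerivAt_integral_mul_translate hF (hφ.of_le (by simp)) hs v s
  have hg' : ∀ s, HasDerivAt g' (∫ w, F w * secondLineDeriv φ v (w + s • v) ∂μ) s := fun s =>
    hasDerivAt_integral_mul_translate hF ((contDiff_fderiv_apply hφ v).of_le (by simp))
      (hs.fderiv_apply (𝕜 := ℝ) v) v s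
  -- The increment of `g s - g (s - 1)` over `[0, 1]` is `g 1 - 2 g 0 + g (-1)`.
  have hk : ∀ s, HasDerivAt (fun s => g s - g (s - 1)) (g' s - g' (s - 1)) s := fun s =>
    (hg s).sub ((hg (s - 1)).comp_sub_const s 1)
  obtain ⟨ξ, hξ, h1⟩ := exists_hasDerivAt_eq_slope (fun s => g s - g (s - 1)) _ zero_lt_one
    (fun s _ => (hk s).continuousAt.continuousWithinAt) (fun s _ => hk s)
  obtain ⟨η, hη, h2⟩ := exists_hasDerivAt_eq_slope g' _ (sub_one_lt ξ)
    (fun s _ => (hg' s).continuousAt.continuousWithinAt) (fun s _ => hg' s)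
  refine ⟨η, ⟨by linarith [hη.1, hξ.1], by linarith [hη.2, hξ.2]⟩, ?_⟩
  rw [h2, sub_sub_cancel, div_one, h1]
  have hi : ∀ s : ℝ, Integrable (fun w => F w * φ (w + s • v)) μ := fun s =>
    continuous_mul_integrable hF (hφ.continuous.comp (by fun_prop))
      (hasCompactSupport_translate hs _)
  have e : ∀ w, F w * secondDifference φ v w =
      F w * φ (w + (1 : ℝ) • v) + F w * φ (w + (-1 : ℝ) • v) - 2 * (F w * φ (w + (0 : ℝ) • v)) := by
    intro w
    simp only [secondDifference, one_smul, neg_smul, zero_smul, add_zero, ← sub_eq_add_neg]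
    ring
  simp_rw [e]
  rw [integral_add_sub_two_mul (hi 1) (hi (-1)) (hi 0)]
  simp only [g]
  norm_num
  ring

omit [NormedSpace ℝ E] [FiniteDimensional ℝ E] in
lemma integral_secondDifference_mul {F φ : E → ℝ} (hF : Continuous F)
    (hφ : Continuous φ) (hs : HasCompactSupport φ) (v : E) :
    ∫ w, secondDifference F v w * φ w ∂μ = ∫ w, F w * secondDifference φ v w ∂μ := by
  have h1 : ∀ u : E, Integrable (fun w => F (w + u) * φ w) μ := fun u =>
    continuous_mul_integrable (hF.comp (by fun_prop)) hφ hs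
  have h2 : ∀ u : E, Integrable (fun w => F w * φ (w + u)) μ := fun u =>
    continuous_mul_integrable hF (hφ.comp (by fun_prop)) (hasCompactSupport_translate hs u)
  have h3 : ∀ u : E, ∫ w, F (w + u) * φ w ∂μ = ∫ w, F w * φ (w + -u) ∂μ := fun u => by
    rw [← integral_add_right_eq_self (μ := μ) (fun w => F w * φ (w + -u)) u]
    simp
  have e1 : ∀ w, secondDifference F v w * φ w =
      F (w + v) * φ w + F (w + -v) * φ w - 2 * (F (w + 0) * φ w) := fun w => by
    simp only [secondDifference, add_zero, ← sub_eq_add_neg]; ring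
  have e2 : ∀ w, F w * secondDifference φ v w =
      F w * φ (w + v) + F w * φ (w + -v) - 2 * (F w * φ (w + 0)) := fun w => by
    simp only [secondDifference, add_zero, ← sub_eq_add_neg]; ring
  simp_rw [e1, e2]
  rw [integral_add_sub_two_mul (h1 _) (h1 _) (h1 _), integral_add_sub_two_mul (h2 _) (h2 _) (h2 _),
    h3, h3, h3]
  simp only [neg_neg, neg_zero]
  ring

end SecondDifference

/-! ### Blow-ups of Radon measures at almost every point. -/

section BlowUp

variable {E : Type*} [NormedAddCommGroup E] [NormedSpace ℝ E] [FiniteDimensional ℝ E]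
  [MeasurableSpace E] [BorelSpace E] {μ : Measure E} [μ.IsAddHaarMeasure]

omit [μ.IsAddHaarMeasure] in
lemma locallyIntegrable_toReal_rnDeriv (ν : Measure E) [IsLocallyFiniteMeasure ν] :
    LocallyIntegrable (fun x => (ν.rnDeriv μ x).toReal) μ := by
  rw [locallyIntegrable_iff]
  intro K hK
  refine integrable_toReal_of_lintegral_ne_top (Measure.measurable_rnDeriv ν μ).aemeasurable ?_
  exact ((Measure.setLIntegral_rnDeriv_le K).trans_lt hK.measure_lt_top).ne

lemma integral_comp_inv_smul_sub {x : E} {r : ℝ} (hr : 0 < r) (g : E → ℝ) :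
    ∫ y, g (r⁻¹ • (y - x)) ∂μ = r ^ Module.finrank ℝ E * ∫ w, g w ∂μ := by
  rw [integral_sub_right_eq_self (μ := μ) (fun y => g (r⁻¹ • y)) x,
    Measure.integral_comp_inv_smul_of_nonneg μ g hr.le, smul_eq_mul]

omit [FiniteDimensional ℝ E] [MeasurableSpace E] [BorelSpace E] in
lemma comp_inv_smul_sub_eq_zero {x y : E} {r R : ℝ} (hr : 0 < r) {φ : E → ℝ}
    (hs : ∀ w, R < ‖w‖ → φ w = 0) (hy : y ∉ Metric.closedBall x (R * r)) :
    φ (r⁻¹ • (y - x)) = 0 := by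
  refine hs _ ?_
  rw [Metric.mem_closedBall, not_le, dist_eq_norm] at hy
  rw [norm_smul, norm_inv, Real.norm_of_nonneg hr.le, ← div_eq_inv_mul, lt_div_iff₀ hr]
  exact hy

omit [BorelSpace E] in
/-- Bound for rescaled test functions against a measure. -/
lemma abs_integral_comp_inv_smul_sub_le (ν : Measure E) [IsLocallyFiniteMeasure ν] {g : E → ℝ}
    (hg : LocallyIntegrable g ν) {x : E} {r R M : ℝ} (hr : 0 < r) {φ : E → ℝ}
    (hM : ∀ w, |φ w| ≤ M) (hs : ∀ w, R < ‖w‖ → φ w = 0) :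
    |∫ y, φ (r⁻¹ • (y - x)) * g y ∂ν| ≤ M * ∫ y in Metric.closedBall x (R * r), |g y| ∂ν := by
  have h0 : ∀ y ∉ Metric.closedBall x (R * r), φ (r⁻¹ • (y - x)) * g y = 0 := fun y hy => by
    rw [comp_inv_smul_sub_eq_zero hr hs hy, zero_mul]
  rw [← setIntegral_eq_integral_of_forall_compl_eq_zero h0, ← integral_const_mul]
  refine norm_integral_le_of_norm_le (f := fun y => φ (r⁻¹ • (y - x)) * g y)
    (((hg.integrableOn_isCompact (isCompact_closedBall x (R * r))).norm).const_mul M)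
    (.of_forall fun y => ?_)
  rw [norm_mul]
  exact mul_le_mul_of_nonneg_right (hM _) (norm_nonneg _)

/-- Almost every point is a blow-up point of `ν`: the rescaled measures converge to a multiple of
the Lebesgue measure, uniformly over bounded test functions with bounded support. -/
lemma ae_eventually_blowup (ν : Measure E) [IsLocallyFiniteMeasure ν] :
    ∀ᵐ x ∂μ, ∀ R > 0, ∀ M > 0, ∀ ε > 0, ∀ᶠ r in 𝓝[>] (0 : ℝ), ∀ φ : E → ℝ, Continuous φ →
      (∀ w, |φ w| ≤ M) → (∀ w, R < ‖w‖ → φ w = 0) →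
      |(r ^ Module.finrank ℝ E)⁻¹ * ∫ y, φ (r⁻¹ • (y - x)) ∂ν -
        (ν.rnDeriv μ x).toReal * ∫ w, φ w ∂μ| ≤ ε := by
  set g : E → ℝ := fun x => (ν.rnDeriv μ x).toReal with hgdef
  have hg : LocallyIntegrable g μ := locallyIntegrable_toReal_rnDeriv ν
  have hsing := Besicovitch.ae_tendsto_rnDeriv (ν.singularPart μ) μ
  have hzero := Measure.rnDeriv_eq_zero_of_mutuallySingular
    (Measure.mutuallySingular_singularPart ν μ) (Measure.AbsolutelyContinuous.refl μ)
  have hleb := (Besicovitch.vitaliFamily μ).ae_tendsto_average_norm_sub hg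
  filter_upwards [hsing, hzero, hleb] with x h1 h2 h3 R hR M hM ε hε
  -- The good points: the singular part has density zero with respect to balls, and `x` is a
  -- Lebesgue point of the density `g`.
  rw [h2] at h1
  replace h3 := h3.comp (Besicovitch.tendsto_filterAt μ x)
  have h1' := (ENNReal.tendsto_toReal ENNReal.zero_ne_top).comp h1
  set V := μ.real (Metric.closedBall (0 : E) R) with hV
  have hscale : Tendsto (fun r : ℝ => R * r) (𝓝[>] 0) (𝓝[>] 0) := by
    refine tendsto_nhdsWithin_iff.2 ⟨?_, ?_⟩
    · have : Tendsto (fun r : ℝ => R * r) (𝓝 0) (𝓝 (R * 0)) :=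
        tendsto_id.const_mul R
      rw [mul_zero] at this
      exact this.mono_left nhdsWithin_le_nhds
    · filter_upwards [self_mem_nhdsWithin] with r hr using mul_pos hR hr
  have hsum := ((h1'.comp hscale).add (h3.comp hscale)).const_mul (M * V)
  simp only [ENNReal.toReal_zero, add_zero, mul_zero] at hsum
  filter_upwards [hsum.eventually_le_const hε, self_mem_nhdsWithin] with r hr hr0 φ hφ hφM hφs
  replace hr0 : 0 < r := hr0
  refine le_trans ?_ hr
  have hvol : μ.real (Metric.closedBall x (R * r)) = r ^ Module.finrank ℝ E * V := by
    rw [mul_comm R r, measureReal_def, Measure.addHaar_closedBall_mul μ x hr0.le hR.le,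
      ENNReal.toReal_mul, ENNReal.toReal_ofReal (by positivity), hV, measureReal_def]
  have hrd : 0 < r ^ Module.finrank ℝ E := by positivity
  have hVpos : 0 < V := by
    rw [hV, measureReal_def]
    exact ENNReal.toReal_pos (Metric.measure_closedBall_pos μ 0 hR).ne'
      (isCompact_closedBall 0 R).measure_lt_top.ne
  have hφr : Continuous fun y => φ (r⁻¹ • (y - x)) := by fun_prop
  have hφc : HasCompactSupport fun y => φ (r⁻¹ • (y - x)) :=
    HasCompactSupport.intro (isCompact_closedBall x (R * r))
      fun y hy => comp_inv_smul_sub_eq_zero hr0 hφs hy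
  have hint : ∀ (ρ : Measure E) [IsLocallyFiniteMeasure ρ],
      Integrable (fun y => φ (r⁻¹ • (y - x))) ρ := fun ρ _ =>
    hφr.integrable_of_hasCompactSupport hφc
  have hgi : Integrable (fun y => φ (r⁻¹ • (y - x)) * g y) μ := by
    simpa only [smul_eq_mul] using hg.integrable_smul_left_of_hasCompactSupport hφr hφc
  have hdec : ∫ y, φ (r⁻¹ • (y - x)) ∂ν = ∫ y, φ (r⁻¹ • (y - x)) * 1 ∂(ν.singularPart μ) +
      ∫ y, φ (r⁻¹ • (y - x)) * g y ∂μ := by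
    conv_lhs => rw [← Measure.singularPart_add_rnDeriv ν μ]
    rw [integral_add_measure (hint _) (hint _),
      integral_withDensity_eq_integral_toReal_smul (Measure.measurable_rnDeriv ν μ)
        (Measure.rnDeriv_lt_top ν μ)]
    simp [g, mul_comm]
  have e2 : ∫ y, φ (r⁻¹ • (y - x)) * (g y - g x) ∂μ =
      ∫ y, φ (r⁻¹ • (y - x)) * g y ∂μ - (r ^ Module.finrank ℝ E * ∫ w, φ w ∂μ) * g x := by
    simp_rw [mul_sub]
    rw [integral_sub hgi ((hint μ).mul_const _), integral_mul_const,
      integral_comp_inv_smul_sub hr0]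
  have b1 := abs_integral_comp_inv_smul_sub_le (ν.singularPart μ) (g := fun _ => 1)
    (locallyIntegrable_const 1) (x := x) hr0 hφM hφs
  have b2 := abs_integral_comp_inv_smul_sub_le μ (g := fun y => g y - g x)
    (hg.sub (locallyIntegrable_const _)) (x := x) hr0 hφM hφs
  rw [abs_one, setIntegral_const, smul_eq_mul, mul_one] at b1
  -- The error splits into the singular mass and the oscillation of `g` around `g x`, both on the
  -- ball of radius `R * r`.
  have key : (r ^ Module.finrank ℝ E)⁻¹ * ∫ y, φ (r⁻¹ • (y - x)) ∂ν - g x * ∫ w, φ w ∂μ =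
      (r ^ Module.finrank ℝ E)⁻¹ * (∫ y, φ (r⁻¹ • (y - x)) * 1 ∂(ν.singularPart μ) +
        ∫ y, φ (r⁻¹ • (y - x)) * (g y - g x) ∂μ) := by
    rw [hdec, e2]; field_simp; ring
  rw [key, abs_mul, abs_of_pos (inv_pos.2 hrd)]
  have : M * V * (((fun r => (ν.singularPart μ) (Metric.closedBall x r) /
      μ (Metric.closedBall x r)) (R * r)).toReal + ⨍ y in Metric.closedBall x (R * r), ‖g y - g x‖ ∂μ)
      = (r ^ Module.finrank ℝ E)⁻¹ * (M * (ν.singularPart μ).real (Metric.closedBall x (R * r)) +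
        M * ∫ y in Metric.closedBall x (R * r), |g y - g x| ∂μ) := by
    rw [setAverage_eq, ENNReal.toReal_div, ← measureReal_def, ← measureReal_def, hvol, smul_eq_mul]
    simp only [Real.norm_eq_abs]
    field_simp
  refine le_trans ?_ this.ge
  refine mul_le_mul_of_nonneg_left ((abs_add_le _ _).trans (add_le_add b1 b2))
    (inv_pos.2 hrd).le

/-- The test function may vary with `r`, which is what the translations by `η • v` require; the
uniformity of `ae_eventually_blowup` permits it. -/
lemma ae_tendsto_blowup (ν : Measure E) [IsLocallyFiniteMeasure ν] :
    ∀ᵐ x ∂μ, ∀ R M c : ℝ, ∀ φ : ℝ → E → ℝ, (∀ r, Continuous (φ r)) → (∀ r w, |φ r w| ≤ M) →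
      (∀ r w, R < ‖w‖ → φ r w = 0) → (∀ r, ∫ w, φ r w ∂μ = c) →
      Tendsto (fun r : ℝ => (r ^ Module.finrank ℝ E)⁻¹ * ∫ y, φ r (r⁻¹ • (y - x)) ∂ν) (𝓝[>] 0)
        (𝓝 ((ν.rnDeriv μ x).toReal * c)) := by
  filter_upwards [ae_eventually_blowup (μ := μ) ν] with x hx R M c φ h1 h2 h3 h4
  rw [Metric.tendsto_nhds]
  intro ε hε
  filter_upwards [hx (max R 1) (by positivity) (max M 1) (by positivity) (ε / 2) (half_pos hε)]
    with r hr
  have := hr (φ r) (h1 r) (fun w => (h2 r w).trans (le_max_left _ _))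
    (fun w hw => h3 r w ((le_max_left _ _).trans_lt hw))
  rw [h4] at this
  exact this.trans_lt (half_lt_self hε)

end BlowUp

/-! ### Weak convergence of the second differences of the blow-ups. -/

section KeyLimit

variable {d : ℕ}

lemma secondPartial_eq {φ : EuclideanSpace ℝ (Fin d) → ℝ}
    (hφ : ContDiff ℝ ((⊤ : ℕ∞) : WithTop ℕ∞) φ) (i j : Fin d) (w : EuclideanSpace ℝ (Fin d)) :
    secondPartial i j φ w = fderiv ℝ (fderiv ℝ φ) w (EuclideanSpace.single i 1)
      (EuclideanSpace.single j 1) := by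
  have h : DifferentiableAt ℝ (fderiv ℝ φ) w :=
    ((hφ.fderiv_right (m := ((⊤ : ℕ∞) : WithTop ℕ∞)) (by simp)).differentiable (by simp)) w
  rw [secondPartial, fderiv_clm_apply h (differentiableAt_const _)]
  simp

lemma secondLineDeriv_eq {E : Type*} [NormedAddCommGroup E] [NormedSpace ℝ E] {φ : E → ℝ}
    (hφ : ContDiff ℝ ((⊤ : ℕ∞) : WithTop ℕ∞) φ) (v w : E) :
    secondLineDeriv φ v w = fderiv ℝ (fderiv ℝ φ) w v v := by
  have h : DifferentiableAt ℝ (fderiv ℝ φ) w :=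
    ((hφ.fderiv_right (m := ((⊤ : ℕ∞) : WithTop ℕ∞)) (by simp)).differentiable (by simp)) w
  rw [secondLineDeriv, fderiv_clm_apply h (differentiableAt_const _)]
  simp

lemma secondLineDeriv_eq_sum {φ : EuclideanSpace ℝ (Fin d) → ℝ}
    (hφ : ContDiff ℝ ((⊤ : ℕ∞) : WithTop ℕ∞) φ) (v w : EuclideanSpace ℝ (Fin d)) :
    secondLineDeriv φ v w = ∑ i, ∑ j, v i * v j * secondPartial i j φ w := by
  have hv : v = ∑ i, v i • EuclideanSpace.single i (1 : ℝ) := by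
    simpa using ((EuclideanSpace.basisFun (Fin d) ℝ).sum_repr v).symm
  simp_rw [secondLineDeriv_eq hφ, secondPartial_eq hφ]
  conv_lhs => rw [hv]
  simp only [map_sum, map_smul, _root_.sum_apply, _root_.smul_apply,
    smul_eq_mul, Finset.mul_sum]
  rw [Finset.sum_comm]
  exact Finset.sum_congr rfl fun i _ => Finset.sum_congr rfl fun j _ => by ring

lemma fderiv_comp_smul_sub_apply {E : Type*} [NormedAddCommGroup E] [NormedSpace ℝ E] (g : E → ℝ)
    (c : ℝ) (x y u : E) :
    fderiv ℝ (fun y => g (c • (y - x))) y u = c * fderiv ℝ g (c • (y - x)) u := by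
  rw [fderiv_comp_sub (f := fun y => g (c • y)) (x := y) x, fderiv_comp_smul]
  simp

lemma secondPartial_comp_smul_sub {φ : EuclideanSpace ℝ (Fin d) → ℝ}
    (hφ : ContDiff ℝ ((⊤ : ℕ∞) : WithTop ℕ∞) φ) (i j : Fin d) (c : ℝ) (x y : EuclideanSpace ℝ (Fin d)) :
    secondPartial i j (fun y => φ (c • (y - x))) y =
      c ^ 2 * secondPartial i j φ (c • (y - x)) := by
  simp only [secondPartial, fderiv_comp_smul_sub_apply]
  have hd : DifferentiableAt ℝ
      (fun y => fderiv ℝ φ (c • (y - x)) (EuclideanSpace.single j 1)) y :=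
    (((contDiff_fderiv_apply hφ (EuclideanSpace.single j 1)).comp
      (by fun_prop : ContDiff ℝ ((⊤ : ℕ∞) : WithTop ℕ∞) fun y => c • (y - x))).differentiable
      (by simp)) y
  simp_rw [← smul_eq_mul (a := c)]
  rw [fderiv_fun_const_smul hd, _root_.smul_apply,
    fderiv_comp_smul_sub_apply (fun y => fderiv ℝ φ y (EuclideanSpace.single j 1))]
  simp only [smul_eq_mul]
  ring

lemma secondPartial_comp_add (φ : EuclideanSpace ℝ (Fin d) → ℝ) (i j : Fin d)
    (a w : EuclideanSpace ℝ (Fin d)) :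
    secondPartial i j (fun w => φ (w + a)) w = secondPartial i j φ (w + a) := by
  simp only [secondPartial, fderiv_comp_add_right]
  rw [fderiv_comp_add_right (f := fun y => fderiv ℝ φ y (EuclideanSpace.single j 1))]

lemma continuous_secondPartial {φ : EuclideanSpace ℝ (Fin d) → ℝ}
    (hφ : ContDiff ℝ ((⊤ : ℕ∞) : WithTop ℕ∞) φ) (i j : Fin d) :
    Continuous (secondPartial i j φ) :=
  (contDiff_fderiv_apply (contDiff_fderiv_apply hφ _) _).continuous

lemma hasCompactSupport_secondPartial {φ : EuclideanSpace ℝ (Fin d) → ℝ}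
    (hφ : HasCompactSupport φ) (i j : Fin d) : HasCompactSupport (secondPartial i j φ) :=
  (hφ.fderiv_apply (𝕜 := ℝ) _).fderiv_apply (𝕜 := ℝ) _

/-- Change of variables `y = x + r • w`: the volume contributes `r ^ d`, and the two derivatives of
the rescaled test function contribute `r⁻²`. -/
lemma integral_comp_mul_secondPartial {f : EuclideanSpace ℝ (Fin d) → ℝ}
    {μ : Matrix (Fin d) (Fin d) (SignedRadonMeasure d)} (hμ : IsSecondDerivativeMeasure f μ)
    {φ : EuclideanSpace ℝ (Fin d) → ℝ} (hφ : ContDiff ℝ ((⊤ : ℕ∞) : WithTop ℕ∞) φ)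
    (hs : HasCompactSupport φ) (i j : Fin d) (x : EuclideanSpace ℝ (Fin d)) {r : ℝ} (hr : 0 < r) :
    (r ^ 2)⁻¹ * ∫ w, f (x + r • w) * secondPartial i j φ w =
      (r ^ Module.finrank ℝ (EuclideanSpace ℝ (Fin d)))⁻¹ *
        (μ i j).integral (fun y => φ (r⁻¹ • (y - x))) := by
  have hs' : HasCompactSupport fun y => φ (r⁻¹ • (y - x)) := by
    have := (hasCompactSupport_translate (hs.comp_smul (inv_pos.2 hr).ne') (-x))
    simpa only [← sub_eq_add_neg] using this
  have hc : ContDiff ℝ ((⊤ : ℕ∞) : WithTop ℕ∞) fun y => φ (r⁻¹ • (y - x)) :=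
    hφ.comp (by fun_prop)
  rw [hμ i j _ hc hs']
  simp_rw [secondPartial_comp_smul_sub hφ]
  have h := integral_comp_inv_smul_sub (μ := volume) (x := x) hr
    (fun w => f (x + r • w) * (r⁻¹ ^ 2 * secondPartial i j φ w))
  simp only [smul_inv_smul₀ hr.ne', add_sub_cancel] at h
  rw [h, ← mul_assoc, inv_mul_cancel₀ (pow_pos hr _).ne', one_mul, ← integral_const_mul]
  congr 1 with w
  rw [inv_pow]; ring

/-- At almost every point the second differences of the blow-ups of `f` converge weakly to the
quadratic form of the density of the second derivative measure. -/
lemma ae_tendsto_integral_secondDifference {f : EuclideanSpace ℝ (Fin d) → ℝ} (hf : Continuous f)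
    {μ : Matrix (Fin d) (Fin d) (SignedRadonMeasure d)} (hμ : IsSecondDerivativeMeasure f μ) :
    ∀ᵐ x : EuclideanSpace ℝ (Fin d), ∀ φ : EuclideanSpace ℝ (Fin d) → ℝ,
      ContDiff ℝ ((⊤ : ℕ∞) : WithTop ℕ∞) φ → HasCompactSupport φ → ∀ v,
      Tendsto (fun r : ℝ => (r ^ 2)⁻¹ *
          ∫ w, secondDifference (fun w => f (x + r • w)) v w * φ w) (𝓝[>] 0)
        (𝓝 (inner ℝ ((densityMatrix μ x).toEuclideanLin v) v * ∫ w, φ w)) := by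
  have hpos : ∀ i j, IsLocallyFiniteMeasure (μ i j).pos := fun i j => (μ i j).isLocallyFinite_pos
  have hneg : ∀ i j, IsLocallyFiniteMeasure (μ i j).neg := fun i j => (μ i j).isLocallyFinite_neg
  filter_upwards [ae_all_iff.2 fun i => ae_all_iff.2 fun j =>
      ae_tendsto_blowup (μ := volume) (μ i j).pos,
    ae_all_iff.2 fun i => ae_all_iff.2 fun j => ae_tendsto_blowup (μ := volume) (μ i j).neg]
    with x h1 h2 φ hφ hs v
  have hfx : ∀ r : ℝ, Continuous fun w => f (x + r • w) := fun r => by fun_prop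
  choose η hη hηe using fun r : ℝ =>
    exists_integral_mul_secondDifference_eq (μ := volume) (hfx r) hφ hs v
  -- Since `|η r| < 1`, these translates share a sup bound, a support radius `R + ‖v‖` and an
  -- integral, as `ae_tendsto_blowup` demands.
  set ψ : ℝ → EuclideanSpace ℝ (Fin d) → ℝ := fun r w => φ (w + η r • v) with hψ
  have hψc : ∀ r, ContDiff ℝ ((⊤ : ℕ∞) : WithTop ℕ∞) (ψ r) := fun r => hφ.comp (by fun_prop)
  have hψs : ∀ r, HasCompactSupport (ψ r) := fun r => hasCompactSupport_translate hs _
  obtain ⟨M, hM⟩ := hφ.continuous.bounded_above_of_compact_support hs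
  obtain ⟨R, hR⟩ := hs.isCompact.isBounded.subset_closedBall (0 : EuclideanSpace ℝ (Fin d))
  have hψR : ∀ r w, R + ‖v‖ < ‖w‖ → ψ r w = 0 := fun r w hw => by
    by_contra hne
    have h3 := hR (subset_tsupport φ hne)
    rw [mem_closedBall_zero_iff] at h3
    have h4 : ‖η r • v‖ ≤ 1 * ‖v‖ := by
      rw [norm_smul]
      exact mul_le_mul_of_nonneg_right (abs_le.2 ⟨(hη r).1.le, (hη r).2.le⟩) (norm_nonneg _)
    have h5 : ‖w‖ ≤ ‖w + η r • v‖ + ‖η r • v‖ := by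
      simpa using norm_sub_le (w + η r • v) (η r • v)
    linarith
  have hψi : ∀ r, ∫ w, ψ r w = ∫ w, φ w := fun r => integral_add_right_eq_self φ _
  have key : ∀ i j, Tendsto (fun r : ℝ => v i * v j *
      ((r ^ Module.finrank ℝ (EuclideanSpace ℝ (Fin d)))⁻¹ *
        (μ i j).integral (fun y => ψ r (r⁻¹ • (y - x))))) (𝓝[>] 0)
      (𝓝 (v i * v j * (densityMatrix μ x i j * ∫ w, φ w))) := fun i j => by
    have h3 := (h1 i j (R + ‖v‖) M _ ψ (fun r => (hψc r).continuous) (fun r w => hM _) hψR hψi).sub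
      (h2 i j (R + ‖v‖) M _ ψ (fun r => (hψc r).continuous) (fun r w => hM _) hψR hψi)
    simp_rw [← mul_sub, ← sub_mul] at h3
    exact h3.const_mul _
  have hsum := tendsto_finsetSum Finset.univ fun i _ =>
    tendsto_finsetSum Finset.univ fun j _ => key i j
  have hlim : ∑ i, ∑ j, v i * v j * (densityMatrix μ x i j * ∫ w, φ w) =
      inner ℝ ((densityMatrix μ x).toEuclideanLin v) v * ∫ w, φ w := by
    simp only [PiLp.inner_apply, Matrix.toLpLin_apply, Matrix.mulVec, dotProduct,
      RCLike.inner_apply, conj_trivial, Finset.sum_mul, Finset.mul_sum]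
    refine Finset.sum_congr rfl fun i _ => Finset.sum_congr rfl fun j _ => ?_
    ring
  rw [← hlim]
  refine hsum.congr' ?_
  filter_upwards [self_mem_nhdsWithin] with r hr
  rw [integral_secondDifference_mul (hfx r) hφ.continuous hs, hηe]
  have e : ∀ w, f (x + r • w) * secondLineDeriv φ v (w + η r • v) =
      ∑ i, ∑ j, v i * v j * (f (x + r • w) * secondPartial i j (ψ r) w) := fun w => by
    rw [secondLineDeriv_eq_sum hφ, Finset.mul_sum]
    refine Finset.sum_congr rfl fun i _ => ?_
    rw [Finset.mul_sum]
    refine Finset.sum_congr rfl fun j _ => ?_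
    rw [hψ, secondPartial_comp_add]
    ring
  have hint : ∀ i j, Integrable fun w => v i * v j * (f (x + r • w) * secondPartial i j (ψ r) w) :=
    fun i j => (continuous_mul_integrable (hfx r) (continuous_secondPartial (hψc r) i j)
      (hasCompactSupport_secondPartial (hψs r) i j)).const_mul _
  simp_rw [e]
  rw [integral_finsetSum _ fun i _ => integrable_finsetSum _ fun j _ => hint i j, Finset.mul_sum]
  refine Finset.sum_congr rfl fun i _ => ?_
  rw [integral_finsetSum _ fun j _ => hint i j, Finset.mul_sum]
  refine Finset.sum_congr rfl fun j _ => ?_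
  rw [integral_const_mul, mul_left_comm ((r ^ 2)⁻¹),
    integral_comp_mul_secondPartial hμ (hψc r) (hψs r) i j x hr]

end KeyLimit

/-! ### From weak to pointwise second-order expansions of convex functions. -/

section ConvexBounds

/-- A bounded function with asymptotically affine-linear dyadic behaviour converges. -/
lemma tendsto_half_of_tendsto_dyadic {a : ℝ → ℝ} {q B r₀ : ℝ} (hr₀ : 0 < r₀)
    (hB : ∀ r, 0 < r → r < r₀ → |a r| ≤ B)
    (h : Tendsto (fun r => 4 * a (2 * r) - 2 * a r) (𝓝[>] 0) (𝓝 q)) :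
    Tendsto a (𝓝[>] 0) (𝓝 (q / 2)) := by
  rw [Metric.tendsto_nhds]
  intro ε hε
  obtain ⟨r₁, hr₁, h1⟩ := mem_nhdsGT_iff_exists_Ioo_subset.1
    ((Metric.tendsto_nhds.1 h) ε hε)
  replace hr₁ : 0 < r₁ := hr₁
  set r₂ := min r₀ r₁
  have hr₂ : 0 < r₂ := lt_min hr₀ hr₁
  -- The hypothesis at `r / 2` makes passing from `r / 2` to `r` a contraction by `1 / 2` up to a
  -- small error. Iterating down from scale `r`, boundedness of `a` removes the initial term.
  have step : ∀ r, 0 < r → r < r₂ → |a r - q / 2| ≤ |a (r / 2) - q / 2| / 2 + ε / 4 := by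
    intro r h0 h2
    have h3 := h1 (⟨half_pos h0, (half_lt_self h0).trans (h2.trans_le (min_le_right _ _))⟩ :
      r / 2 ∈ Set.Ioo 0 r₁)
    simp only [Set.mem_ofPred_eq, Real.dist_eq, mul_div_cancel₀ r (two_ne_zero' ℝ)] at h3
    have e : a r - q / 2 = (a (r / 2) - q / 2) / 2 + (4 * a r - 2 * a (r / 2) - q) / 4 := by ring
    rw [e]
    refine (abs_add_le _ _).trans (add_le_add ?_ ?_)
    · rw [abs_div, abs_two]
    · rw [abs_div, abs_of_pos (by norm_num : (0 : ℝ) < 4)]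
      exact div_le_div_of_nonneg_right h3.le (by norm_num)
  have iter : ∀ n : ℕ, ∀ r, 0 < r → r < r₂ →
      |a r - q / 2| ≤ (B + |q / 2|) * (1 / 2) ^ n + ε / 2 := by
    intro n
    induction n with
    | zero =>
      intro r h0 h2
      have := abs_sub (a r) (q / 2)
      have := hB r h0 (h2.trans_le (min_le_left _ _))
      rw [pow_zero, mul_one]
      linarith
    | succ n ih =>
      intro r h0 h2
      have := step r h0 h2
      have := ih (r / 2) (half_pos h0) ((half_lt_self h0).trans h2)
      rw [pow_succ]
      linarith
  have hlim : Tendsto (fun n : ℕ => (B + |q / 2|) * (1 / 2 : ℝ) ^ n) atTop (𝓝 0) := by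
    simpa using (tendsto_pow_atTop_nhds_zero_of_lt_one (r := (1 / 2 : ℝ)) (by norm_num)
      (by norm_num)).const_mul (B + |q / 2|)
  obtain ⟨n, hn⟩ := (hlim.eventually_lt_const (half_pos hε)).exists
  filter_upwards [Ioo_mem_nhdsGT hr₂] with r hr
  rw [Real.dist_eq]
  linarith [iter n r hr.1 hr.2]

lemma ConvexOn.map_smul_le_of_map_zero {E : Type*} [AddCommGroup E] [Module ℝ E] {g : E → ℝ}
    (hg : ConvexOn ℝ Set.univ g) (h0 : g 0 = 0) (u : E) {s : ℝ} (hs0 : 0 ≤ s) (hs1 : s ≤ 1) :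
    g (s • u) ≤ s * g u := by
  have := hg.2 (Set.mem_univ u) (Set.mem_univ 0) hs0 (sub_nonneg.2 hs1) (by ring)
  simpa [h0] using this

variable {d : ℕ}

/-- The sum of the values of `g` at the vertices `± d eᵢ` of a cross-polytope. -/
noncomputable def vertexSum (g : EuclideanSpace ℝ (Fin d) → ℝ) : ℝ :=
  ∑ i : Fin d, (g ((d : ℝ) • EuclideanSpace.single i 1) + g (-((d : ℝ) • EuclideanSpace.single i 1)))

lemma vertexSum_nonneg {g : EuclideanSpace ℝ (Fin d) → ℝ} (hnn : ∀ w, 0 ≤ g w) :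
    0 ≤ vertexSum g :=
  Finset.sum_nonneg fun _ _ => add_nonneg (hnn _) (hnn _)

/-- The unit ball lies in the cross-polytope with vertices `± d eᵢ`: `w` is the mean of the points
`wᵢ d eᵢ`, each on a segment from `0` to a vertex because `|wᵢ| ≤ 1`. Jensen's inequality concludes.
-/
lemma ConvexOn.le_vertexSum {g : EuclideanSpace ℝ (Fin d) → ℝ} (hg : ConvexOn ℝ Set.univ g)
    (hnn : ∀ w, 0 ≤ g w) (h0 : g 0 = 0) {w : EuclideanSpace ℝ (Fin d)} (hw : ‖w‖ ≤ 1) :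
    g w ≤ vertexSum g := by
  rcases Nat.eq_zero_or_pos d with rfl | hd
  · rw [Subsingleton.elim w 0, h0]
    exact vertexSum_nonneg hnn
  have hd' : (1 : ℝ) ≤ d := by exact_mod_cast hd
  have hsum : w = ∑ i : Fin d, (1 / (d : ℝ)) • (w i • ((d : ℝ) • EuclideanSpace.single i (1 : ℝ))) := by
    have h1 : w = ∑ i, w i • EuclideanSpace.single i (1 : ℝ) := by
      simpa using ((EuclideanSpace.basisFun (Fin d) ℝ).sum_repr w).symm
    conv_lhs => rw [h1]
    refine Finset.sum_congr rfl fun i _ => ?_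
    rw [smul_comm (w i), smul_smul, one_div, inv_mul_cancel₀ (by positivity), one_smul]
  have hJ := hg.map_sum_le (t := Finset.univ) (w := fun _ : Fin d => 1 / (d : ℝ))
    (p := fun i => w i • ((d : ℝ) • EuclideanSpace.single i (1 : ℝ)))
    (fun _ _ => by positivity) (by simp [show (d : ℝ) ≠ 0 by positivity])
    (fun _ _ => Set.mem_univ _)
  rw [← hsum] at hJ
  refine hJ.trans (Finset.sum_le_sum fun i _ => ?_)
  rw [smul_eq_mul]
  have hwi : |w i| ≤ 1 := (PiLp.norm_apply_le w i).trans hw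
  have hval : g (w i • ((d : ℝ) • EuclideanSpace.single i (1 : ℝ))) ≤
      g ((d : ℝ) • EuclideanSpace.single i 1) + g (-((d : ℝ) • EuclideanSpace.single i 1)) := by
    set e := (d : ℝ) • EuclideanSpace.single i (1 : ℝ)
    rcases le_total 0 (w i) with h | h
    · rw [abs_of_nonneg h] at hwi
      have := hg.map_smul_le_of_map_zero h0 e h hwi
      nlinarith [hnn e, hnn (-e)]
    · rw [abs_of_nonpos h] at hwi
      have := hg.map_smul_le_of_map_zero h0 (-e) (neg_nonneg.2 h) hwi
      rw [smul_neg, neg_smul, neg_neg] at this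
      nlinarith [hnn e, hnn (-e)]
  have hdi : 1 / (d : ℝ) ≤ 1 := by rw [div_le_one (by positivity)]; exact hd'
  have h1 := hnn ((d : ℝ) • EuclideanSpace.single i (1 : ℝ))
  have h2 := hnn (-((d : ℝ) • EuclideanSpace.single i (1 : ℝ)))
  calc _ ≤ 1 / (d : ℝ) * _ := mul_le_mul_of_nonneg_left hval (by positivity)
    _ ≤ _ := mul_le_of_le_one_left (add_nonneg h1 h2) hdi

lemma ConvexOn.le_mul_vertexSum {g : EuclideanSpace ℝ (Fin d) → ℝ} (hg : ConvexOn ℝ Set.univ g)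
    (hnn : ∀ w, 0 ≤ g w) (h0 : g 0 = 0) {w : EuclideanSpace ℝ (Fin d)} {δ : ℝ} (hδ : 0 < δ)
    (hδ1 : δ ≤ 1) (hw : ‖w‖ ≤ δ) : g w ≤ δ * vertexSum g := by
  have h1 : ‖δ⁻¹ • w‖ ≤ 1 := by
    rw [norm_smul, norm_inv, Real.norm_of_nonneg hδ.le, ← div_eq_inv_mul]
    exact div_le_one_of_le₀ hw hδ.le
  have h2 := hg.map_smul_le_of_map_zero h0 (δ⁻¹ • w) hδ.le hδ1
  rw [smul_inv_smul₀ hδ.ne'] at h2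
  exact h2.trans (mul_le_mul_of_nonneg_left (hg.le_vertexSum hnn h0 h1) hδ.le)

/-- Adding the second differences at `w` and `-w` lets midpoint convexity replace the shifted values
by `2 (g v + g (-v))`. The subtracted terms `g (± w)` are at most `δ * vertexSum g`; with `δ = 1 /
(4 d + 1)` their total over the `d` directions is at most one `vertexSum g`, out of the two
available. -/
lemma ConvexOn.vertexSum_le_sum_secondDifference {g : EuclideanSpace ℝ (Fin d) → ℝ}
    (hg : ConvexOn ℝ Set.univ g) (hnn : ∀ w, 0 ≤ g w) (h0 : g 0 = 0)
    {w : EuclideanSpace ℝ (Fin d)} (hw : ‖w‖ ≤ 1 / (4 * d + 1)) :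
    vertexSum g ≤ ∑ i : Fin d, (secondDifference g ((d : ℝ) • EuclideanSpace.single i 1) w +
      secondDifference g ((d : ℝ) • EuclideanSpace.single i 1) (-w)) := by
  set δ : ℝ := 1 / (4 * d + 1) with hδ
  have hδ0 : 0 < δ := by positivity
  have hδ1 : δ ≤ 1 := by
    rw [hδ, div_le_one (by positivity)]
    linarith [(Nat.cast_nonneg d : (0 : ℝ) ≤ d)]
  have hS := vertexSum_nonneg hnn
  have h1 := hg.le_mul_vertexSum hnn h0 hδ0 hδ1 hw
  have h2 := hg.le_mul_vertexSum hnn h0 hδ0 hδ1 (by rwa [norm_neg] : ‖-w‖ ≤ δ)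
  have hmid : ∀ a b : EuclideanSpace ℝ (Fin d), 2 * g b ≤ g (a + b) + g (-a + b) := fun a b => by
    have := hg.2 (Set.mem_univ (a + b)) (Set.mem_univ (-a + b)) (by norm_num : (0 : ℝ) ≤ 1 / 2)
      (by norm_num : (0 : ℝ) ≤ 1 / 2) (by norm_num)
    have e : (1 / 2 : ℝ) • (a + b) + (1 / 2 : ℝ) • (-a + b) = b := by module
    rw [e, smul_eq_mul, smul_eq_mul] at this
    linarith
  have hterm : ∀ v : EuclideanSpace ℝ (Fin d), 2 * (g v + g (-v)) - 4 * δ * vertexSum g ≤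
      secondDifference g v w + secondDifference g v (-w) := fun v => by
    have h3 := hmid w v
    have h4 := hmid w (-v)
    rw [← sub_eq_add_neg, ← sub_eq_add_neg] at h4
    simp only [secondDifference]
    linarith
  have hsum := Finset.sum_le_sum fun (i : Fin d) (_ : i ∈ Finset.univ) =>
    hterm ((d : ℝ) • EuclideanSpace.single i 1)
  rw [Finset.sum_sub_distrib, ← Finset.mul_sum] at hsum
  refine le_trans ?_ hsum
  change _ ≤ 2 * vertexSum g - _
  rw [Finset.sum_const, Finset.card_univ, Fintype.card_fin, nsmul_eq_mul]
  have h5 : (d : ℝ) * (4 * δ) ≤ 1 := by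
    rw [hδ, mul_one_div, mul_div_assoc', div_le_one (by positivity)]
    linarith
  nlinarith

lemma secondDifference_continuous {E : Type*} [NormedAddCommGroup E] {g : E → ℝ}
    (hg : Continuous g) (v : E) : Continuous (secondDifference g v) := by
  unfold secondDifference
  fun_prop

/-- The values of a nonnegative convex function near its zero at the origin are controlled by
mollified second differences. -/
lemma ConvexOn.vertexSum_le_integral {g : EuclideanSpace ℝ (Fin d) → ℝ}
    (hg : ConvexOn ℝ Set.univ g) (hgc : Continuous g) (hnn : ∀ w, 0 ≤ g w) (h0 : g 0 = 0)
    {φ : EuclideanSpace ℝ (Fin d) → ℝ} (hφ : Continuous φ) (hs : HasCompactSupport φ)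
    (hφ0 : ∀ w, 0 ≤ φ w) (hφe : ∀ w, φ (-w) = φ w) (hφ1 : ∫ w, φ w = 1)
    (hφs : ∀ w, φ w ≠ 0 → ‖w‖ ≤ 1 / (4 * d + 1)) :
    vertexSum g ≤ 2 * ∑ i : Fin d,
      ∫ w, secondDifference g ((d : ℝ) • EuclideanSpace.single i 1) w * φ w := by
  set e : Fin d → EuclideanSpace ℝ (Fin d) := fun i => (d : ℝ) • EuclideanSpace.single i 1
  have hi : ∀ i, Integrable fun w => secondDifference g (e i) w * φ w := fun i =>
    continuous_mul_integrable (secondDifference_continuous hgc _) hφ hs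
  have hi' : ∀ i, Integrable fun w => secondDifference g (e i) (-w) * φ w := fun i =>
    continuous_mul_integrable ((secondDifference_continuous hgc _).comp continuous_neg) hφ hs
  have hneg : ∀ i, ∫ w, secondDifference g (e i) (-w) * φ w =
      ∫ w, secondDifference g (e i) w * φ w := fun i => by
    rw [← integral_neg_eq_self]
    simp [hφe]
  have hsum : ∫ w, ∑ i, (secondDifference g (e i) w * φ w + secondDifference g (e i) (-w) * φ w) =
      2 * ∑ i, ∫ w, secondDifference g (e i) w * φ w := by
    have hadd : ∀ i, Integrable fun w =>
        secondDifference g (e i) w * φ w + secondDifference g (e i) (-w) * φ w := fun i =>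
      (hi i).add (hi' i)
    rw [integral_finsetSum _ fun i _ => hadd i, Finset.mul_sum]
    refine Finset.sum_congr rfl fun i _ => ?_
    rw [integral_add (hi i) (hi' i), hneg, two_mul]
  rw [← hsum, ← mul_one (vertexSum g), ← hφ1, ← integral_const_mul]
  refine integral_mono ((hφ.integrable_of_hasCompactSupport hs).const_mul _)
    (integrable_finsetSum _ fun i _ => (hi i).add (hi' i)) fun w => ?_
  simp only [← add_mul, ← Finset.sum_mul]
  by_cases hw : φ w = 0
  · simp [hw]
  · exact mul_le_mul_of_nonneg_right
      (hg.vertexSum_le_sum_secondDifference hnn h0 (hφs w hw)) (hφ0 w)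

/-- Weak convergence of the second differences of the parabolic blow-ups of `G` at the origin. -/
def HasWeakSecondDifference (G q : EuclideanSpace ℝ (Fin d) → ℝ) : Prop :=
  ∀ φ : EuclideanSpace ℝ (Fin d) → ℝ, ContDiff ℝ ((⊤ : ℕ∞) : WithTop ℕ∞) φ →
    HasCompactSupport φ → ∀ v, Tendsto (fun r : ℝ => (r ^ 2)⁻¹ *
      ∫ w, secondDifference (fun w => G (r • w)) v w * φ w) (𝓝[>] 0) (𝓝 (q v * ∫ w, φ w))

lemma ConvexOn.comp_const_smul {G : EuclideanSpace ℝ (Fin d) → ℝ} (hG : ConvexOn ℝ Set.univ G)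
    (r : ℝ) : ConvexOn ℝ Set.univ fun w => G (r • w) :=
  hG.comp_linearMap (LinearMap.lsmul ℝ (EuclideanSpace ℝ (Fin d)) r)

lemma ConvexOn.continuous_of_univ {G : EuclideanSpace ℝ (Fin d) → ℝ}
    (hG : ConvexOn ℝ Set.univ G) : Continuous G :=
  continuousOn_univ.1 (hG.continuousOn isOpen_univ)

/-- Blowing up at scale `r = ‖w‖` moves `w` to the unit sphere, where the blow-up is bounded by its
mollified second differences. After division by `r²` these converge, hence stay bounded. -/
lemma ConvexOn.exists_le_mul_sq {G q : EuclideanSpace ℝ (Fin d) → ℝ}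
    (hG : ConvexOn ℝ Set.univ G) (hnn : ∀ w, 0 ≤ G w) (h0 : G 0 = 0)
    (hq : HasWeakSecondDifference G q) :
    ∃ C > 0, ∃ r₀ > 0, ∀ w, ‖w‖ < r₀ → G w ≤ C * ‖w‖ ^ 2 := by
  have hGc := hG.continuous_of_univ
  have hδ : (0 : ℝ) < 1 / (4 * d + 1) := by positivity
  let b : ContDiffBump (0 : EuclideanSpace ℝ (Fin d)) := ⟨_, _, half_pos hδ, half_lt_self hδ⟩
  have hlim := (tendsto_finsetSum Finset.univ fun i _ => hq (b.normed volume)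
    b.contDiff_normed b.hasCompactSupport_normed
    ((d : ℝ) • EuclideanSpace.single i (1 : ℝ))).const_mul 2
  set L : ℝ := 2 * ∑ i : Fin d, q ((d : ℝ) • EuclideanSpace.single i (1 : ℝ)) *
    ∫ w, b.normed volume w
  have hev := hlim.eventually_lt_const (lt_add_of_le_of_pos (le_abs_self L) one_pos)
  obtain ⟨r₀, hr₀, h1⟩ := mem_nhdsGT_iff_exists_Ioo_subset.1 hev
  refine ⟨|L| + 1, by positivity, r₀, hr₀, fun w hw => ?_⟩
  rcases eq_or_ne w 0 with rfl | hw0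
  · simp [h0]
  have hn : 0 < ‖w‖ := norm_pos_iff.2 hw0
  have h2 := h1 (⟨hn, hw⟩ : ‖w‖ ∈ Set.Ioo 0 r₀)
  simp only [Set.mem_ofPred_eq, ← Finset.mul_sum] at h2
  have hgr := hG.comp_const_smul ‖w‖
  have h3 := hgr.vertexSum_le_integral (by fun_prop) (fun _ => hnn _) (by simp [h0])
    b.continuous_normed b.hasCompactSupport_normed (fun _ => b.nonneg_normed _)
    (fun u => by rw [b.normed_neg]) b.integral_normed (fun u hu => by
      have h4 : u ∈ Function.support (b.normed volume) := hu
      rw [b.support_normed_eq, mem_ball_zero_iff] at h4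
      exact h4.le)
  have h5 := hgr.le_vertexSum (fun _ => hnn _) (by simp [h0]) (w := ‖w‖⁻¹ • w)
    (by rw [norm_smul, norm_inv, norm_norm, inv_mul_cancel₀ hn.ne'])
  simp only [smul_inv_smul₀ hn.ne'] at h5
  rw [mul_left_comm, inv_mul_lt_iff₀ (by positivity)] at h2
  calc G w ≤ _ := h5.trans h3
    _ ≤ _ := h2.le
    _ = _ := mul_comm _ _

lemma secondDifference_const_mul {E : Type*} [AddCommGroup E] (g : E → ℝ) (c : ℝ) (v w : E) :
    secondDifference (fun w => c * g w) v w = c * secondDifference g v w := by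
  simp only [secondDifference]; ring

/-- Alexandrov's expansion: weak convergence of second differences of a convex function upgrades
to pointwise convergence of its parabolic blow-ups. -/
lemma ConvexOn.tendsto_blowup {G q : EuclideanSpace ℝ (Fin d) → ℝ}
    (hG : ConvexOn ℝ Set.univ G) (hnn : ∀ w, 0 ≤ G w) (h0 : G 0 = 0)
    (hq : HasWeakSecondDifference G q) (v : EuclideanSpace ℝ (Fin d)) :
    Tendsto (fun r : ℝ => (r ^ 2)⁻¹ * G (r • v)) (𝓝[>] 0) (𝓝 (q v / 2)) := by
  have hGc := hG.continuous_of_univ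
  obtain ⟨C, hC, r₀, hr₀, hbound⟩ := hG.exists_le_mul_sq hnn h0 hq
  -- The points `w ± v` with `‖w - v‖ < 1` lie in the ball of radius `ρ - 1`; the remaining unit is
  -- the margin that turns a bound on a convex function into a Lipschitz constant.
  set ρ : ℝ := 2 * ‖v‖ + 3 with hρ
  have hρ0 : 0 < ρ := by positivity
  have hb : ∀ r, 0 < r → r < r₀ / ρ → ∀ w, ‖w‖ < ρ → |(r ^ 2)⁻¹ * G (r • w)| ≤ C * ρ ^ 2 := by
    intro r hr hr1 w hw
    have h1 : ‖r • w‖ = r * ‖w‖ := by rw [norm_smul, Real.norm_of_nonneg hr.le]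
    have h2 : r * ‖w‖ < r₀ := by
      rw [lt_div_iff₀ hρ0] at hr1
      exact (mul_le_mul_of_nonneg_left hw.le hr.le).trans_lt hr1
    rw [abs_of_nonneg (mul_nonneg (by positivity) (hnn _)), inv_mul_le_iff₀ (by positivity)]
    refine (hbound _ (h1 ▸ h2)).trans ?_
    rw [h1, mul_pow, mul_left_comm]
    gcongr
  refine tendsto_half_of_tendsto_dyadic (B := C * ρ ^ 2) (div_pos hr₀ hρ0)
    (fun r hr hr1 => hb r hr hr1 v (by linarith [norm_nonneg v])) ?_
  set K : ℝ≥0 := (2 * (C * ρ ^ 2) / 1).toNNReal with hK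
  have hlip : ∀ r, 0 < r → r < r₀ / ρ →
      LipschitzOnWith K (fun w => (r ^ 2)⁻¹ * G (r • w)) (Metric.ball 0 (ρ - 1)) := by
    intro r hr hr1
    refine ConvexOn.lipschitzOnWith_of_abs_le ?_ one_pos
      fun a ha => hb r hr hr1 a (by simpa using ha)
    exact (((hG.comp_const_smul r).smul (by positivity : (0 : ℝ) ≤ (r ^ 2)⁻¹))).subset
      (Set.subset_univ _) (convex_ball _ _)
  rw [Metric.tendsto_nhds]
  intro ε hε
  -- A second difference has coefficients `1, 1, -2`, so moving its base point by `δ` changes it by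
  -- at most `4 K δ`.
  obtain ⟨δ, hδ0, hδ1, hδε⟩ : ∃ δ : ℝ, 0 < δ ∧ δ ≤ 1 ∧ 4 * K * δ ≤ ε / 2 := by
    refine ⟨min 1 (ε / 2 / (4 * K + 1)), by positivity, min_le_left _ _, ?_⟩
    calc 4 * (K : ℝ) * min 1 (ε / 2 / (4 * K + 1)) ≤ (4 * K + 1) * (ε / 2 / (4 * K + 1)) := by
          gcongr
          · linarith
          · exact min_le_right _ _
      _ = ε / 2 := by field_simp
  let b : ContDiffBump v := ⟨_, _, half_pos hδ0, half_lt_self hδ0⟩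
  have hlim := hq (b.normed volume) b.contDiff_normed b.hasCompactSupport_normed v
  rw [b.integral_normed, mul_one] at hlim
  filter_upwards [(Metric.tendsto_nhds.1 hlim) (ε / 2) (half_pos hε),
    Ioo_mem_nhdsGT (div_pos hr₀ hρ0)] with r h1 hr
  set g : EuclideanSpace ℝ (Fin d) → ℝ := fun w => (r ^ 2)⁻¹ * G (r • w) with hg
  have hgc : Continuous g := by fun_prop
  have e1 : (r ^ 2)⁻¹ * ∫ w, secondDifference (fun w => G (r • w)) v w * b.normed volume w =
      ∫ w, secondDifference g v w * b.normed volume w := by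
    rw [← integral_const_mul]
    simp only [hg, secondDifference_const_mul, mul_assoc]
  have e2 : 4 * ((2 * r) ^ 2)⁻¹ * G ((2 * r) • v) - 2 * ((r ^ 2)⁻¹ * G (r • v)) =
      secondDifference g v v := by
    have h2 : r • (v + v) = (2 * r) • v := by module
    simp only [secondDifference, hg, h2, sub_self, smul_zero, h0, mul_zero, add_zero]
    rw [mul_pow, mul_inv]
    ring
  rw [e1, Real.dist_eq] at h1
  rw [← mul_assoc, e2, Real.dist_eq]
  have hL := hlip r hr.1 hr.2
  have hdiff : |(∫ w, secondDifference g v w * b.normed volume w) - secondDifference g v v| ≤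
      ε / 2 := by
    have hi := continuous_mul_integrable (μ := volume) (secondDifference_continuous hgc v)
      b.continuous_normed (b.hasCompactSupport_normed (μ := volume))
    have e3 : (∫ w, secondDifference g v w * b.normed volume w) - secondDifference g v v =
        ∫ w, (secondDifference g v w - secondDifference g v v) * b.normed volume w := by
      simp_rw [sub_mul]
      rw [integral_sub hi (b.integrable_normed.const_mul _), integral_const_mul, b.integral_normed,
        mul_one]
    have e4 : ∫ w, ε / 2 * b.normed volume w = ε / 2 := by
      rw [integral_const_mul, b.integral_normed, mul_one]
    rw [e3]
    refine (norm_integral_le_of_norm_le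
      (f := fun w => (secondDifference g v w - secondDifference g v v) * b.normed volume w)
      (b.integrable_normed.const_mul (ε / 2))
      (.of_forall fun w => ?_)).trans e4.le
    rw [norm_mul, Real.norm_of_nonneg (b.nonneg_normed w)]
    by_cases hw : b.normed volume w = 0
    · simp [hw]
    refine mul_le_mul_of_nonneg_right ?_ (b.nonneg_normed w)
    have hwb : ‖w - v‖ < δ := by
      have h4 : w ∈ Function.support (b.normed volume) := hw
      rw [b.support_normed_eq, Metric.mem_ball, dist_eq_norm] at h4
      exact h4
    have hwn : ‖w‖ < ‖v‖ + 1 := by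
      have := norm_add_le (w - v) v
      rw [sub_add_cancel] at this
      linarith
    have hmem : ∀ u, ‖u‖ < ρ - 1 → u ∈ Metric.ball (0 : EuclideanSpace ℝ (Fin d)) (ρ - 1) :=
      fun u hu => by simpa using hu
    have hv := norm_nonneg v
    have d1 := hL.dist_le_mul (w + v) (hmem _ (by linarith [norm_add_le w v])) (v + v)
      (hmem _ (by linarith [norm_add_le v v]))
    have d2 := hL.dist_le_mul (w - v) (hmem _ (by linarith [norm_sub_le w v])) (v - v)
      (hmem _ (by rw [sub_self, norm_zero]; linarith))
    have d3 := hL.dist_le_mul w (hmem _ (by linarith)) v (hmem _ (by linarith))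
    rw [dist_add_right, Real.dist_eq, dist_eq_norm] at d1
    rw [dist_sub_right, Real.dist_eq, dist_eq_norm] at d2
    rw [Real.dist_eq, dist_eq_norm] at d3
    have hKδ : (K : ℝ) * ‖w - v‖ ≤ K * δ := mul_le_mul_of_nonneg_left hwb.le K.2
    have e5 : secondDifference g v w - secondDifference g v v =
        (g (w + v) - g (v + v)) + (g (w - v) - g (v - v)) - 2 * (g w - g v) := by
      simp only [secondDifference]; ring
    rw [e5, Real.norm_eq_abs]
    refine (abs_sub _ _).trans ((add_le_add_left (abs_add_le _ _) _).trans ?_)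
    rw [abs_mul, abs_two]
    linarith
  rw [abs_sub_comm] at hdiff
  linarith [abs_sub_le (secondDifference g v v)
    (∫ w, secondDifference g v w * b.normed volume w) (q v)]

end ConvexBounds

/-! ### Brownian scaling and dominated convergence. -/

section GaussianScaling

variable {d : ℕ}

lemma multivariateGaussian_smul_one {t : ℝ} (ht : 0 ≤ t) :
    multivariateGaussian (0 : EuclideanSpace ℝ (Fin d)) (t • (1 : Matrix (Fin d) (Fin d) ℝ)) =
      (stdGaussian (EuclideanSpace ℝ (Fin d))).map fun z => √t • z := by
  have hm : IsProbabilityMeasure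
      ((stdGaussian (EuclideanSpace ℝ (Fin d))).map fun z => √t • z) :=
    Measure.isProbabilityMeasure_map (by fun_prop)
  refine Measure.ext_of_charFun (funext fun u => ?_)
  rw [charFun_multivariateGaussian (Matrix.PosSemidef.one.smul ht), charFun_map_smul,
    charFun_stdGaussian, norm_smul, Real.norm_of_nonneg (Real.sqrt_nonneg t)]
  congr 1
  have h : u.ofLp ⬝ᵥ u.ofLp = ‖u‖ ^ 2 := by
    rw [EuclideanSpace.real_norm_sq_eq]
    simp [dotProduct, sq]
  rw [Matrix.smul_mulVec, Matrix.one_mulVec, dotProduct_smul, h, ← Complex.ofReal_pow,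
    mul_pow, Real.sq_sqrt ht]
  simp [neg_div]

lemma integrable_norm_pow_of_isGaussian (γ : Measure (EuclideanSpace ℝ (Fin d))) [IsGaussian γ]
    (n : ℕ) : Integrable (fun z => ‖z‖ ^ n) γ := by
  rcases Nat.eq_zero_or_pos n with rfl | hn
  · simp
  · exact (IsGaussian.memLp_id γ n (by simp)).integrable_norm_pow hn.ne'

/-- A continuous function that is `o(‖w‖²)` along rays at the origin and has polynomial growth has
expectation `o(t)` along a Brownian motion. -/
lemma IsBrownianMotion.tendsto_integral_abs {Ω : Type*} {mΩ : MeasurableSpace Ω} {P : Measure Ω}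
    {ℱ : Filtration ℝ≥0 mΩ} {W : ℝ≥0 → Ω → EuclideanSpace ℝ (Fin d)}
    (hW : IsBrownianMotion P ℱ W) {R : EuclideanSpace ℝ (Fin d) → ℝ} (hR : Continuous R)
    {A B : ℝ} {k : ℕ} (hB : 0 ≤ B) (hbound : ∀ w, |R w| ≤ A * ‖w‖ ^ 2 + B * ‖w‖ ^ (k + 2))
    (hlim : ∀ w, Tendsto (fun r : ℝ => (r ^ 2)⁻¹ * R (r • w)) (𝓝[>] 0) (𝓝 0)) :
    (∀ t, Integrable (fun ω => R (W t ω)) P) ∧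
    Tendsto (fun t : ℝ≥0 => (1 / (t : ℝ)) * ∫ ω, |R (W t ω)| ∂P) (𝓝[>] 0) (𝓝 0) := by
  set γ := stdGaussian (EuclideanSpace ℝ (Fin d))
  have hlaw : ∀ t : ℝ≥0, HasLaw (W t) (γ.map fun z => √(t : ℝ) • z) P := fun t => by
    have h := hW.hasLaw_increment 0 t zero_le
    rw [NNReal.coe_zero, sub_zero, multivariateGaussian_smul_one t.coe_nonneg] at h
    refine h.congr ?_
    filter_upwards [hW.eval_zero] with ω hω
    rw [hω, sub_zero]
  have hdom : Integrable (fun z => A * ‖z‖ ^ 2 + B * ‖z‖ ^ (k + 2)) γ :=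
    ((integrable_norm_pow_of_isGaussian γ 2).const_mul A).add
      ((integrable_norm_pow_of_isGaussian γ (k + 2)).const_mul B)
  have hint : ∀ t : ℝ≥0, Integrable R (γ.map fun z => √(t : ℝ) • z) := fun t => by
    rw [integrable_map_measure hR.aestronglyMeasurable (by fun_prop)]
    refine Integrable.mono' (g := fun z => A * ‖√(t : ℝ) • z‖ ^ 2 + B * ‖√(t : ℝ) • z‖ ^ (k + 2))
      ?_ (by fun_prop) (.of_forall fun z => hbound _)
    simp_rw [norm_smul, mul_pow]
    exact (((integrable_norm_pow_of_isGaussian γ 2).const_mul _).const_mul A).add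
      (((integrable_norm_pow_of_isGaussian γ (k + 2)).const_mul _).const_mul B)
  refine ⟨fun t => ?_, ?_⟩
  · have h := hint t
    rw [← (hlaw t).map_eq] at h
    exact h.comp_aemeasurable (hlaw t).aemeasurable
  have hmean : ∀ t : ℝ≥0, (1 / (t : ℝ)) * ∫ ω, |R (W t ω)| ∂P =
      ∫ z, |(√(t : ℝ) ^ 2)⁻¹ * R (√(t : ℝ) • z)| ∂γ := fun t => by
    have h1 := (hlaw t).integral_comp (f := fun w => |R w|) (by fun_prop)
    have h2 : ∫ ω, |R (W t ω)| ∂P = ∫ z, |R (√(t : ℝ) • z)| ∂γ := by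
      rw [← integral_map (φ := fun z => √(t : ℝ) • z) (f := fun w => |R w|) (by fun_prop)
        (by fun_prop)]
      exact h1
    rw [h2, ← integral_const_mul]
    congr 1 with z
    rw [abs_mul, abs_of_nonneg (by positivity : 0 ≤ (√(t : ℝ) ^ 2)⁻¹), Real.sq_sqrt t.coe_nonneg, one_div]
  simp_rw [hmean]
  have hmain : Tendsto (fun r : ℝ => ∫ z, |(r ^ 2)⁻¹ * R (r • z)| ∂γ) (𝓝[>] 0) (𝓝 0) := by
    suffices h : Tendsto (fun r : ℝ => ∫ z, |(r ^ 2)⁻¹ * R (r • z)| ∂γ) (𝓝[>] 0)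
        (𝓝 (∫ _, (0 : ℝ) ∂γ)) by simpa using h
    refine tendsto_integral_filter_of_dominated_convergence
      (fun z => A * ‖z‖ ^ 2 + B * ‖z‖ ^ (k + 2)) (.of_forall fun r => by fun_prop) ?_ hdom
      (.of_forall fun z => by simpa using (hlim z).abs)
    -- For `r < 1` the factor `r ^ (k + 2)` still beats `r²`, so the bound at `r = 1` dominates; it
    -- has no term of order below two.
    filter_upwards [Ioo_mem_nhdsGT (zero_lt_one' ℝ)] with r hr
    refine .of_forall fun z => ?_
    rw [Real.norm_eq_abs, abs_abs, abs_mul, abs_of_pos (inv_pos.2 (pow_pos hr.1 2)),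
      inv_mul_le_iff₀ (pow_pos hr.1 2)]
    refine (hbound _).trans ?_
    rw [norm_smul, Real.norm_of_nonneg hr.1.le, mul_pow, mul_pow, pow_add r]
    have h1 : r ^ k ≤ 1 := pow_le_one₀ hr.1.le hr.2.le
    have h2 : 0 ≤ B * (r ^ 2 * ‖z‖ ^ (k + 2)) := by positivity
    nlinarith
  refine hmain.comp (tendsto_nhdsWithin_iff.2 ⟨?_, ?_⟩)
  · have : Tendsto (fun t : ℝ≥0 => √(t : ℝ)) (𝓝 0) (𝓝 (√((0 : ℝ≥0) : ℝ))) :=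
      (by fun_prop : Continuous fun t : ℝ≥0 => √(t : ℝ)).tendsto 0
    rw [NNReal.coe_zero, Real.sqrt_zero] at this
    exact this.mono_left nhdsWithin_le_nhds
  · filter_upwards [self_mem_nhdsWithin] with t ht
    exact Real.sqrt_pos.2 (NNReal.coe_pos.2 ht)

end GaussianScaling

/-! ### Existence of the second derivative measure. -/

section SecondDerivativeMeasure

open scoped CompactlySupported

variable {d : ℕ}

lemma secondLineDeriv_smul {E : Type*} [NormedAddCommGroup E] [NormedSpace ℝ E] {φ : E → ℝ}
    (hφ : ContDiff ℝ ((⊤ : ℕ∞) : WithTop ℕ∞) φ) (h : ℝ) (v w : E) :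
    secondLineDeriv φ (h • v) w = h ^ 2 * secondLineDeriv φ v w := by
  simp only [secondLineDeriv_eq hφ, map_smul, _root_.smul_apply, smul_eq_mul]
  ring

lemma tendsto_integral_secondDifference_smul {f φ : EuclideanSpace ℝ (Fin d) → ℝ}
    (hf : Continuous f) (hφ : ContDiff ℝ ((⊤ : ℕ∞) : WithTop ℕ∞) φ) (hs : HasCompactSupport φ)
    (v : EuclideanSpace ℝ (Fin d)) :
    Tendsto (fun h : ℝ => (h ^ 2)⁻¹ * ∫ w, secondDifference f (h • v) w * φ w) (𝓝[>] 0)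
      (𝓝 (∫ w, f w * secondLineDeriv φ v w)) := by
  choose η hη hηe using fun h : ℝ =>
    exists_integral_mul_secondDifference_eq (μ := volume) hf hφ hs (h • v)
  set g : ℝ → ℝ := fun s => ∫ w, f w * secondLineDeriv φ v (w + s • v)
  have hg : ContinuousAt g 0 := (hasDerivAt_integral_mul_translate hf
    ((contDiff_fderiv_apply (contDiff_fderiv_apply hφ v) v).of_le (by simp))
    ((hs.fderiv_apply (𝕜 := ℝ) v).fderiv_apply (𝕜 := ℝ) v) v 0).continuousAt
  have hηh : Tendsto (fun h : ℝ => η h * h) (𝓝[>] 0) (𝓝 0) := by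
    have hid : Tendsto (fun h : ℝ => |h|) (𝓝[>] 0) (𝓝 0) := by
      simpa using (tendsto_id.mono_left nhdsWithin_le_nhds : Tendsto id (𝓝[>] (0 : ℝ)) (𝓝 0)).abs
    refine squeeze_zero_norm (fun h => ?_) hid
    rw [norm_mul, Real.norm_eq_abs, Real.norm_eq_abs]
    exact mul_le_of_le_one_left (abs_nonneg h) (abs_le.2 ⟨(hη h).1.le, (hη h).2.le⟩)
  have hlim := hg.tendsto.comp hηh
  have e : g 0 = ∫ w, f w * secondLineDeriv φ v w := by simp [g]
  rw [e] at hlim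
  refine hlim.congr' ?_
  filter_upwards [self_mem_nhdsWithin] with h hh
  replace hh : 0 < h := hh
  rw [integral_secondDifference_mul hf hφ.continuous hs, hηe, ← integral_const_mul]
  change ∫ w, f w * secondLineDeriv φ v (w + (η h * h) • v) = _
  congr 1 with w
  rw [secondLineDeriv_smul hφ, smul_smul]
  field_simp

lemma ConvexOn.secondDifference_nonneg {f : EuclideanSpace ℝ (Fin d) → ℝ}
    (hf : ConvexOn ℝ Set.univ f) (v w : EuclideanSpace ℝ (Fin d)) : 0 ≤ secondDifference f v w := by
  have := hf.2 (Set.mem_univ (w + v)) (Set.mem_univ (w - v)) (by norm_num : (0 : ℝ) ≤ 1 / 2)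
    (by norm_num : (0 : ℝ) ≤ 1 / 2) (by norm_num)
  have e : (1 / 2 : ℝ) • (w + v) + (1 / 2 : ℝ) • (w - v) = w := by module
  rw [e, smul_eq_mul, smul_eq_mul] at this
  simp only [secondDifference]
  linarith

/-- For merely continuous `φ` convergence is not yet known, but second differences of `f` are
nonnegative, so `|φ|` can be replaced by a multiple of a smooth bump, for which it is. -/
lemma ConvexOn.exists_abs_integral_secondDifference_le {f φ : EuclideanSpace ℝ (Fin d) → ℝ}
    (hf : ConvexOn ℝ Set.univ f) (hφ : Continuous φ) (hs : HasCompactSupport φ)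
    (v : EuclideanSpace ℝ (Fin d)) :
    ∃ B : ℝ, ∀ᶠ h : ℝ in 𝓝[>] 0,
      |(h ^ 2)⁻¹ * ∫ w, secondDifference f (h • v) w * φ w| ≤ B := by
  have hfc := hf.continuous_of_univ
  obtain ⟨M, hM⟩ := hφ.bounded_above_of_compact_support hs
  have hM0 : 0 ≤ M := (norm_nonneg _).trans (hM 0)
  obtain ⟨R, hR⟩ := hs.isCompact.isBounded.subset_closedBall (0 : EuclideanSpace ℝ (Fin d))
  let b : ContDiffBump (0 : EuclideanSpace ℝ (Fin d)) :=
    ⟨max R 1, max R 1 + 1, by positivity, lt_add_one _⟩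
  have hlim := (tendsto_integral_secondDifference_smul hfc b.contDiff b.hasCompactSupport v)
  refine ⟨M * (|∫ w, f w * secondLineDeriv b v w| + 1), ?_⟩
  filter_upwards [hlim.eventually_lt_const (lt_add_of_le_of_pos (le_abs_self _) one_pos)] with h hh
  have hφb : ∀ w, |φ w| ≤ M * b w := fun w => by
    by_cases hw : φ w = 0
    · rw [hw, abs_zero]
      exact mul_nonneg hM0 b.nonneg
    · have h1 := hR (subset_tsupport φ hw)
      rw [b.one_of_mem_closedBall (Metric.closedBall_subset_closedBall (le_max_left _ _) h1),
        mul_one]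
      exact hM w
  have hsD : Continuous (secondDifference f (h • v)) := secondDifference_continuous hfc _
  have hi := continuous_mul_integrable (μ := volume) hsD b.continuous b.hasCompactSupport
  rw [abs_mul, abs_of_nonneg (by positivity : 0 ≤ (h ^ 2)⁻¹)]
  have h2 : |∫ w, secondDifference f (h • v) w * φ w| ≤
      M * ∫ w, secondDifference f (h • v) w * b w := by
    rw [← integral_const_mul]
    refine norm_integral_le_of_norm_le (f := fun w => secondDifference f (h • v) w * φ w)
      (hi.const_mul M) (.of_forall fun w => ?_)
    rw [norm_mul, Real.norm_of_nonneg (hf.secondDifference_nonneg _ _), mul_left_comm]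
    exact mul_le_mul_of_nonneg_left (hφb w) (hf.secondDifference_nonneg _ _)
  calc _ ≤ (h ^ 2)⁻¹ * (M * ∫ w, secondDifference f (h • v) w * b w) :=
        mul_le_mul_of_nonneg_left h2 (by positivity)
    _ = M * ((h ^ 2)⁻¹ * ∫ w, secondDifference f (h • v) w * b w) := by ring
    _ ≤ _ := mul_le_mul_of_nonneg_left hh.le hM0

/-- The pure second distributional derivative of a convex function is a Radon measure. -/
lemma ConvexOn.exists_measure_secondLineDeriv {f : EuclideanSpace ℝ (Fin d) → ℝ}
    (hf : ConvexOn ℝ Set.univ f) (v : EuclideanSpace ℝ (Fin d)) :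
    ∃ ν : Measure (EuclideanSpace ℝ (Fin d)), IsLocallyFiniteMeasure ν ∧
      ∀ φ : EuclideanSpace ℝ (Fin d) → ℝ, ContDiff ℝ ((⊤ : ℕ∞) : WithTop ℕ∞) φ →
        HasCompactSupport φ → ∫ w, φ w ∂ν = ∫ w, f w * secondLineDeriv φ v w := by
  have hfc := hf.continuous_of_univ
  -- Bounded quantities converge along an ultrafilter, which gives one linear positive limit on all
  -- of `C_c`. On smooth functions it agrees with the genuine limit.
  set U : Ultrafilter ℝ := Ultrafilter.of (𝓝[>] (0 : ℝ))
  have hU : (U : Filter ℝ) ≤ 𝓝[>] 0 := Ultrafilter.of_le _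
  set L : ℝ → (EuclideanSpace ℝ (Fin d) → ℝ) → ℝ := fun h φ =>
    (h ^ 2)⁻¹ * ∫ w, secondDifference f (h • v) w * φ w with hL
  have hex : ∀ φ : C_c(EuclideanSpace ℝ (Fin d), ℝ), ∃ l : ℝ, Tendsto (fun h => L h φ) U (𝓝 l) := by
    intro φ
    obtain ⟨B, hB⟩ := hf.exists_abs_integral_secondDifference_le φ.continuous φ.hasCompactSupport v
    obtain ⟨l, -, hl⟩ := (isCompact_Icc (a := -B) (b := B)).ultrafilter_le_nhds
      (U.map fun h => L h φ) (by
        rw [le_principal_iff]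
        exact (Filter.Eventually.filter_mono hU hB).mono fun h hh => abs_le.1 hh)
    exact ⟨l, hl⟩
  choose Λ hΛ using hex
  have hi : ∀ (h : ℝ) (φ : C_c(EuclideanSpace ℝ (Fin d), ℝ)),
      Integrable fun w => secondDifference f (h • v) w * φ w := fun h φ =>
    continuous_mul_integrable (secondDifference_continuous hfc _) φ.continuous φ.hasCompactSupport
  let Λ' : C_c(EuclideanSpace ℝ (Fin d), ℝ) →ₗ[ℝ] ℝ :=
    { toFun := Λ
      map_add' := fun φ ψ => by
        refine tendsto_nhds_unique (hΛ (φ + ψ)) (((hΛ φ).add (hΛ ψ)).congr fun h => ?_)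
        simp only [hL, CompactlySupportedContinuousMap.coe_add, Pi.add_apply, mul_add]
        rw [integral_add (hi h φ) (hi h ψ), mul_add]
      map_smul' := fun c φ => by
        refine tendsto_nhds_unique (hΛ (c • φ)) (((hΛ φ).const_mul c).congr fun h => ?_)
        simp only [hL, CompactlySupportedContinuousMap.coe_smul, Pi.smul_apply, smul_eq_mul,
          mul_left_comm _ c]
        rw [integral_const_mul, mul_left_comm] }
  let Λp : C_c(EuclideanSpace ℝ (Fin d), ℝ) →ₚ[ℝ] ℝ := PositiveLinearMap.mk₀ Λ' fun φ hφ =>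
    ge_of_tendsto (hΛ φ) (.of_forall fun h => mul_nonneg (by positivity)
      (integral_nonneg fun w => mul_nonneg (hf.secondDifference_nonneg _ _) (hφ w)))
  refine ⟨RealRMK.rieszMeasure Λp, inferInstance, fun φ hφ hs => ?_⟩
  let φ' : C_c(EuclideanSpace ℝ (Fin d), ℝ) := ⟨⟨φ, hφ.continuous⟩, hs⟩
  have h1 : ∫ w, φ w ∂(RealRMK.rieszMeasure Λp) = Λ φ' := RealRMK.integral_rieszMeasure Λp φ'
  rw [h1]
  exact tendsto_nhds_unique (hΛ φ')
    ((tendsto_integral_secondDifference_smul hfc hφ hs v).mono_left hU)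

/-- Polarization of the symmetric Hessian; it presents each `μᵢⱼ` as a difference of two positive
measures. -/
lemma secondPartial_eq_sub {φ : EuclideanSpace ℝ (Fin d) → ℝ}
    (hφ : ContDiff ℝ ((⊤ : ℕ∞) : WithTop ℕ∞) φ) (i j : Fin d) (w : EuclideanSpace ℝ (Fin d)) :
    secondPartial i j φ w =
      secondLineDeriv φ ((1 / 2 : ℝ) • (EuclideanSpace.single i 1 + EuclideanSpace.single j 1)) w -
      secondLineDeriv φ ((1 / 2 : ℝ) • (EuclideanSpace.single i 1 - EuclideanSpace.single j 1)) w := by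
  have hsymm := (hφ.contDiffAt (x := w)).isSymmSndFDerivAt (by
    rw [minSmoothness_of_isRCLikeNormedField]
    exact WithTop.coe_le_coe.2 (le_top : (2 : ℕ∞) ≤ ⊤))
    (EuclideanSpace.single i 1) (EuclideanSpace.single j 1)
  simp only [secondPartial_eq hφ, secondLineDeriv_eq hφ, map_smul, map_add, map_sub,
    _root_.smul_apply, _root_.add_apply, _root_.sub_apply, smul_eq_mul]
  rw [hsymm]
  ring

lemma ConvexOn.exists_isSecondDerivativeMeasure {f : EuclideanSpace ℝ (Fin d) → ℝ}
    (hf : ConvexOn ℝ Set.univ f) :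
    ∃ μ : Matrix (Fin d) (Fin d) (SignedRadonMeasure d), IsSecondDerivativeMeasure f μ := by
  have hfc := hf.continuous_of_univ
  choose ν hν1 hν2 using hf.exists_measure_secondLineDeriv
  refine ⟨fun i j => ⟨ν _, ν _,
    hν1 ((1 / 2 : ℝ) • (EuclideanSpace.single i 1 + EuclideanSpace.single j 1)),
    hν1 ((1 / 2 : ℝ) • (EuclideanSpace.single i 1 - EuclideanSpace.single j 1))⟩,
    fun i j φ hφ hs => ?_⟩
  have hi : ∀ v, Integrable fun w => f w * secondLineDeriv φ v w := fun v =>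
    continuous_mul_integrable hfc (contDiff_fderiv_apply (contDiff_fderiv_apply hφ v) v).continuous
      ((hs.fderiv_apply (𝕜 := ℝ) v).fderiv_apply (𝕜 := ℝ) v)
  simp only [SignedRadonMeasure.integral, hν2 _ φ hφ hs, secondPartial_eq_sub hφ, mul_sub]
  rw [integral_sub (hi _) (hi _)]

end SecondDerivativeMeasure

/-! ### The excess over a supporting affine function, and its growth. -/

section SecondOrderExpansion

variable {d : ℕ}

/-- The excess of `f` over its supporting affine function at `x` with slope `p`. -/
noncomputable def supportExcess (f : EuclideanSpace ℝ (Fin d) → ℝ)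
    (x p w : EuclideanSpace ℝ (Fin d)) : ℝ :=
  f (x + w) - f x - inner ℝ p w

lemma ConvexOn.supportExcess {f : EuclideanSpace ℝ (Fin d) → ℝ} (hf : ConvexOn ℝ Set.univ f)
    (x p : EuclideanSpace ℝ (Fin d)) : ConvexOn ℝ Set.univ (supportExcess f x p) := by
  refine ⟨convex_univ, fun a _ b _ s t hs ht hst => ?_⟩
  have h := hf.2 (Set.mem_univ (x + a)) (Set.mem_univ (x + b)) hs ht hst
  have e : s • (x + a) + t • (x + b) = x + (s • a + t • b) := by
    rw [smul_add, smul_add, add_add_add_comm, ← add_smul, hst, one_smul]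
  rw [e] at h
  simp only [_root_.supportExcess, inner_add_right, real_inner_smul_right, smul_eq_mul] at h ⊢
  have ht' : t = 1 - s := by linarith
  subst ht'
  linarith

lemma secondDifference_supportExcess (f : EuclideanSpace ℝ (Fin d) → ℝ)
    (x p v w : EuclideanSpace ℝ (Fin d)) (r : ℝ) :
    secondDifference (fun w => supportExcess f x p (r • w)) v w =
      secondDifference (fun w => f (x + r • w)) v w := by
  simp only [secondDifference, supportExcess, smul_add, smul_sub, inner_add_right, inner_sub_right]
  ring

lemma HasAtMostPolynomialGrowth.exists_supportExcess_le {f : EuclideanSpace ℝ (Fin d) → ℝ}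
    (hgrowth : HasAtMostPolynomialGrowth f) (x p : EuclideanSpace ℝ (Fin d)) {C r₀ : ℝ}
    (hC : 0 < C) (hr₀ : 0 < r₀) (hloc : ∀ w, ‖w‖ < r₀ → supportExcess f x p w ≤ C * ‖w‖ ^ 2) :
    ∃ B ≥ 0, ∃ k : ℕ, ∀ w, supportExcess f x p w ≤ C * ‖w‖ ^ 2 + B * ‖w‖ ^ (k + 2) := by
  obtain ⟨D, k, hD⟩ := hgrowth
  have hinv : 0 < r₀⁻¹ := inv_pos.2 hr₀
  set A : ℝ := |D| + |f x| + ‖p‖ with hA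
  have hA0 : 0 ≤ A := by positivity
  -- For `‖w‖ ≥ r₀` constants are absorbed through `1 ≤ r₀⁻¹ * ‖w‖`. The first power comes from the
  -- growth of `f (x + w)`; the square supplies two more powers of `‖w‖` and covers the linear term.
  refine ⟨A * (1 + r₀⁻¹ * (1 + ‖x‖)) ^ k * (1 + r₀⁻¹) ^ 2, by positivity, k, fun w => ?_⟩
  rcases lt_or_ge ‖w‖ r₀ with h | h
  · exact (hloc w h).trans (le_add_of_nonneg_right (by positivity))
  have hw : 1 ≤ r₀⁻¹ * ‖w‖ := by rwa [← div_eq_inv_mul, one_le_div hr₀]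
  have hx := norm_nonneg x
  have hwn := norm_nonneg w
  have h1 : 1 + ‖x + w‖ ≤ (1 + r₀⁻¹ * (1 + ‖x‖)) * ‖w‖ := by
    have := norm_add_le x w
    nlinarith
  have h2 : 1 + ‖w‖ ≤ (1 + r₀⁻¹) * ‖w‖ := by linarith
  have h3 : f (x + w) ≤ |D| * (1 + ‖x + w‖) ^ k :=
    (hD _).trans (mul_le_mul_of_nonneg_right (le_abs_self D) (by positivity))
  have hT : 1 ≤ (1 + ‖x + w‖) ^ k := one_le_pow₀ (by linarith [norm_nonneg (x + w)])
  have h4 : -inner ℝ p w ≤ ‖p‖ * ‖w‖ := by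
    rw [← inner_neg_left, ← norm_neg p]
    exact real_inner_le_norm _ _
  have h5 : supportExcess f x p w ≤ A * (1 + ‖x + w‖) ^ k * (1 + ‖w‖) ^ 2 := by
    have hS : 1 ≤ (1 + ‖w‖) ^ 2 := one_le_pow₀ (by linarith)
    have hS' : ‖w‖ ≤ (1 + ‖w‖) ^ 2 := by nlinarith
    have g1 : |D| * (1 + ‖x + w‖) ^ k ≤ |D| * (1 + ‖x + w‖) ^ k * (1 + ‖w‖) ^ 2 :=
      le_mul_of_one_le_right (by positivity) hS
    have g2 : |f x| ≤ |f x| * (1 + ‖x + w‖) ^ k * (1 + ‖w‖) ^ 2 := by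
      rw [mul_assoc]
      exact le_mul_of_one_le_right (abs_nonneg _) (one_le_mul_of_one_le_of_one_le hT hS)
    have g3 : ‖p‖ * ‖w‖ ≤ ‖p‖ * (1 + ‖x + w‖) ^ k * (1 + ‖w‖) ^ 2 := by
      rw [mul_assoc]
      exact mul_le_mul_of_nonneg_left
        (hS'.trans (le_mul_of_one_le_left (by positivity) hT)) (norm_nonneg p)
    have g4 := neg_abs_le (f x)
    rw [hA, add_mul, add_mul, add_mul, add_mul, supportExcess]
    linarith
  calc supportExcess f x p w ≤ _ := h5
    _ ≤ A * ((1 + r₀⁻¹ * (1 + ‖x‖)) * ‖w‖) ^ k * ((1 + r₀⁻¹) * ‖w‖) ^ 2 := by gcongr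
    _ = A * (1 + r₀⁻¹ * (1 + ‖x‖)) ^ k * (1 + r₀⁻¹) ^ 2 * ‖w‖ ^ (k + 2) := by
      rw [mul_pow, mul_pow, pow_add]; ring
    _ ≤ _ := le_add_of_nonneg_left (by positivity)

end SecondOrderExpansion

theorem mainTheorem2 {d : ℕ} {Ω : Type*} {mΩ : MeasurableSpace Ω} (P : Measure Ω)
    [IsProbabilityMeasure P] (ℱ : Filtration ℝ≥0 mΩ)
    (W : ℝ≥0 → Ω → EuclideanSpace ℝ (Fin d)) (hW : IsBrownianMotion P ℱ W)
    (f : EuclideanSpace ℝ (Fin d) → ℝ) (hf : ConvexOn ℝ Set.univ f)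
    (hgrowth : HasAtMostPolynomialGrowth f)
    (p : EuclideanSpace ℝ (Fin d) → EuclideanSpace ℝ (Fin d)) (hp : IsSubgradientChoice f p) :
    (∃ μ : Matrix (Fin d) (Fin d) (SignedRadonMeasure d), IsSecondDerivativeMeasure f μ) ∧
    ∀ μ : Matrix (Fin d) (Fin d) (SignedRadonMeasure d), IsSecondDerivativeMeasure f μ →
      ∀ᵐ x : EuclideanSpace ℝ (Fin d),
        (∀ t : ℝ≥0, Integrable
          (fun ω => secondOrderRemainder f x (p x) (densityMatrix μ x) (W t ω)) P) ∧
        Tendsto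
          (fun t : ℝ≥0 => (1 / (t : ℝ)) *
            ∫ ω, |secondOrderRemainder f x (p x) (densityMatrix μ x) (W t ω)| ∂P)
          (𝓝[>] 0) (𝓝 0) := by
  refine ⟨hf.exists_isSecondDerivativeMeasure, fun μ hμ => ?_⟩
  filter_upwards [ae_tendsto_integral_secondDifference hf.continuous_of_univ hμ] with x hx
  set Q := densityMatrix μ x
  set G := supportExcess f x (p x) with hGdef
  have hG : ConvexOn ℝ Set.univ G := hf.supportExcess x (p x)
  have hGc : Continuous G := hG.continuous_of_univ
  have hnn : ∀ w, 0 ≤ G w := fun w => by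
    have := hp x (x + w)
    rw [add_sub_cancel_left] at this
    simp only [hGdef, supportExcess]
    linarith
  have h0 : G 0 = 0 := by simp [hGdef, supportExcess]
  -- Affine terms have zero second difference, so `G` inherits the weak limit from `f` whichever
  -- subgradient is chosen.
  have hq : HasWeakSecondDifference G fun v => inner ℝ (Q.toEuclideanLin v) v := by
    intro φ hφ hs v
    simpa only [hGdef, secondDifference_supportExcess] using hx φ hφ hs v
  obtain ⟨C, hC, r₀, hr₀, hloc⟩ := hG.exists_le_mul_sq hnn h0 hq
  obtain ⟨B, hB, k, hGB⟩ := hgrowth.exists_supportExcess_le x (p x) hC hr₀ hloc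
  set T := (Q.toEuclideanLin).toContinuousLinearMap
  have hTn : ∀ w, |inner ℝ (Q.toEuclideanLin w) w| ≤ ‖T‖ * ‖w‖ ^ 2 := fun w => by
    refine (abs_real_inner_le_norm _ _).trans ?_
    rw [sq, ← mul_assoc]
    exact mul_le_mul_of_nonneg_right (T.le_opNorm w) (norm_nonneg w)
  have hTc : Continuous fun w => inner ℝ (Q.toEuclideanLin w) w :=
    T.continuous.inner continuous_id
  have hrem : ∀ w, secondOrderRemainder f x (p x) Q w =
      G w - (1 / 2 : ℝ) * inner ℝ (Q.toEuclideanLin w) w := fun _ => rfl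
  refine hW.tendsto_integral_abs (R := secondOrderRemainder f x (p x) Q) (A := C + ‖T‖) (B := B)
    (k := k) ?_ hB (fun w => ?_) (fun w => ?_)
  · exact hGc.sub (continuous_const.mul hTc)
  · rw [hrem]
    refine (abs_sub _ _).trans ?_
    rw [abs_of_nonneg (hnn w), abs_mul, abs_of_pos (by norm_num : (0 : ℝ) < 1 / 2)]
    have h1 : G w ≤ C * ‖w‖ ^ 2 + B * ‖w‖ ^ (k + 2) := hGB w
    have h2 := hTn w
    have h3 := abs_nonneg (inner ℝ (Q.toEuclideanLin w) w)
    linarith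
  · have h1 := (hG.tendsto_blowup hnn h0 hq w).sub_const
      (inner ℝ (Q.toEuclideanLin w) w / 2)
    rw [sub_self] at h1
    refine h1.congr' ?_
    filter_upwards [self_mem_nhdsWithin] with r hr
    have hr' : r ≠ 0 := ne_of_gt hr
    rw [hrem, map_smul, real_inner_smul_left, real_inner_smul_right]
    field_simp
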